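/- Let $m,n\ge 1$ be integers with $\frac1m+\frac1n\le\frac12$, and let $\mathcal U$ be the Euclidean plane if $\frac1m+\frac1n=\frac12$ and the hyperbolic plane if $\frac1m+\frac1n<\frac12$. The universal map $\hat{\mathcal M}(m,n)$ is the tessellation of $\mathcal U$ by regular $m$-gons, $n$ meeting at each vertex; it is nonspherical. Label its vertices by $\mathbf 0$, its edge-centres by $\mathbf 1$ and its face-centres by $\mathbf 2$; these are the geometric points of the map. Let $T$ be a triangle of its subdivision into $(2,m,n)$-triangles, with corners $v_0,v_1,v_2$ labelled $\mathbf 0,\mathbf 1,\mathbf 2$ and angles $\pi/n,\pi/2,\pi/m$ there, and let $P$, $Q$, $R$ be the reflections in the sides $v_0v_1$, $v_1v_2$, $v_0v_2$ of $T$. They generate the extended triangle group $\Gamma(2,m,n)$ of automorphisms of the map, and the triangles of the subdivision are the images of $T$ under this group. The mirror of a reflection is the geodesic line that it fixes. A mirror has pattern $(a_1a_2\cdots a_k)^\infty$ if the geometric points on it, in the order in which they are met when one travels along the line (in one of its two directions), form a two-sided infinite sequence whose labels are the periodic repetition of $a_1a_2\cdots a_k$. Theorem. Every reflection in $\Gamma(2,m,n)$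 is conjugate in $\Gamma(2,m,n)$ to $P$, $Q$ or $R$, and the mirrors of the conjugates of $P$, $Q$, $R$ have the following patterns, which depend only on the parities of $m$ and $n$. - If $m$ and $n$ are odd: $P$, $Q$, $R$ have pattern $(\mathbf{010212})^\infty$. - If $m$ is odd and $n$ is even: $P$ has pattern $(\mathbf{01})^\infty$, and $Q$, $R$ have pattern $(\mathbf{0212})^\infty$. - If $m$ and $n$ are even: $P$, $Q$, $R$ have patterns $(\mathbf{01})^\infty$, $(\mathbf{12})^\infty$, $(\mathbf{02})^\infty$, respectively. - If $m$ is even and $n$ is odd: $P$, $R$ have pattern $(\mathbf{0102})^\infty$, and $Q$ has pattern $(\mathbf{12})^\infty$. -/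

import Mathlib

open Real Filter
open scoped UpperHalfPlane ComplexConjugate

/-- A (complete) geodesic line of a metric space: the image of an isometric embedding of `ℝ`. -/
def IsGeodesicLine {X : Type*} [MetricSpace X] (L : Set X) : Prop :=
  ∃ γ : ℝ → X, Isometry γ ∧ Set.range γ = L

/-- The mirror of an isometry: its set of fixed points. -/
def mirror {X : Type*} [MetricSpace X] (S : X ≃ᵢ X) : Set X :=
  {x | S x = x}

/-- A reflection of a plane: an involutive isometry whose fixed points form a geodesic line.
(`*` on `X ≃ᵢ X` is composition.) -/
def IsPlaneReflection {X : Type*} [MetricSpace X] (S : X ≃ᵢ X) : Prop :=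
  S * S = 1 ∧ IsGeodesicLine (mirror S)

/-- `S` is the reflection in the geodesic line through the points `p` and `q`. -/
def IsReflectionIn {X : Type*} [MetricSpace X] (S : X ≃ᵢ X) (p q : X) : Prop :=
  IsPlaneReflection S ∧ S p = p ∧ S q = q

/-- The angle `∠ q p r` at `p` between the geodesic rays from `p` to `q` and from `p` to `r` in the
hyperbolic plane `ℍ`. The conformal isometry `z ↦ (z - p) / (z - conj p)` of `ℍ` onto the
Poincaré disc takes `p` to `0` and the geodesic rays issuing from `p` to radii of the disc, so the
angle is the Euclidean angle between the images of `q` and `r`, seen as vectors. -/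
noncomputable def hyperbolicAngle (q p r : ℍ) : ℝ :=
  InnerProductGeometry.angle
    (((q : ℂ) - (p : ℂ)) / ((q : ℂ) - conj (p : ℂ)))
    (((r : ℂ) - (p : ℂ)) / ((r : ℂ) - conj (p : ℂ)))

/-- The universal map of type `{m, n}`, drawn in a plane `X` (where `angle q p r` is the angle at
`p`) by means of one of its `(2, m, n)`-triangles. The corners `v0`, `v1`, `v2` of the triangle are
a vertex, the centre of an edge at this vertex, and the centre of a face at this edge;
`P`, `Q`, `R` are the reflections in its `01`-side, `12`-side and `02`-side. All other triangles
of the map are the images of this one under the group generated by `P`, `Q`, `R`. -/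
structure UniversalMap (X : Type*) [MetricSpace X] (angle : X → X → X → ℝ) (m n : ℕ) where
  v0 : X
  v1 : X
  v2 : X
  v0_ne_v1 : v0 ≠ v1
  v1_ne_v2 : v1 ≠ v2
  v0_ne_v2 : v0 ≠ v2
  angle_v0 : angle v1 v0 v2 = π / n
  angle_v1 : angle v0 v1 v2 = π / 2
  angle_v2 : angle v1 v2 v0 = π / m
  P : X ≃ᵢ X
  Q : X ≃ᵢ X
  R : X ≃ᵢ X
  reflection_P : IsReflectionIn P v0 v1
  reflection_Q : IsReflectionIn Q v1 v2
  reflection_R : IsReflectionIn R v0 v2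

namespace UniversalMap

variable {X : Type*} [MetricSpace X] {angle : X → X → X → ℝ} {m n : ℕ}

/-- The extended triangle group `Γ(2, m, n)`, generated by the reflections `P`, `Q`, `R`;
it is the full automorphism group of the map. -/
def extendedTriangleGroup (U : UniversalMap X angle m n) : Subgroup (X ≃ᵢ X) :=
  Subgroup.closure {U.P, U.Q, U.R}

/-- The geometric points of the map with a given label: the vertices (label `0`), the edge-centres
(label `1`) and the face-centres (label `2`), that is, the corners with this label of all the
`(2, m, n)`-triangles of the map. -/
def geometricPoints (U : UniversalMap X angle m n) (a : Fin 3) : Set X :=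
  {x | ∃ g ∈ U.extendedTriangleGroup, x = g (![U.v0, U.v1, U.v2] a)}

/-- The mirror `M` has pattern `(link)^∞`: it is a geodesic line, the geometric points of the
map on it form a sequence, infinite in both directions, of points in the order in which they are met
when one travels along `M`, each geometric point on `M` has exactly one label, and the sequence of
the labels is the two-sided infinite repetition of `link`. -/
def MirrorHasPattern (U : UniversalMap X angle m n) (M : Set X) (link : List (Fin 3)) : Prop :=
  ∃ γ : ℝ → X, Isometry γ ∧ Set.range γ = M ∧
    ∃ t : ℤ → ℝ, StrictMono t ∧ Tendsto t atTop atTop ∧ Tendsto t atBot atBot ∧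
      (∀ s : ℝ, (∃ a, γ s ∈ U.geometricPoints a) ↔ s ∈ Set.range t) ∧
      ∀ (q : ℤ) (j : Fin link.length) (a : Fin 3),
        γ (t (q * link.length + j)) ∈ U.geometricPoints a ↔ a = link[j]

/-- The `S`-reflections of the map (the conjugates of `S` under the automorphisms of the map, i.e.
the reflections in the sides corresponding to `S` of all the triangles) have pattern
`(link)^∞`. -/
def HasPattern (U : UniversalMap X angle m n) (S : X ≃ᵢ X) (link : List (Fin 3)) : Prop :=
  ∀ g ∈ U.extendedTriangleGroup, U.MirrorHasPattern (mirror (g * S * g⁻¹)) link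

/-- The table of the patterns, and its completeness: every reflection among the automorphisms of
the map is a `P`-, a `Q`- or an `R`-reflection. -/
def PatternTable (U : UniversalMap X angle m n) : Prop :=
  (Odd m → Odd n →
    U.HasPattern U.P [0, 1, 0, 2, 1, 2] ∧
    U.HasPattern U.Q [0, 1, 0, 2, 1, 2] ∧
    U.HasPattern U.R [0, 1, 0, 2, 1, 2]) ∧
  (Odd m → Even n →
    U.HasPattern U.P [0, 1] ∧
    U.HasPattern U.Q [0, 2, 1, 2] ∧
    U.HasPattern U.R [0, 2, 1, 2]) ∧
  (Even m → Even n →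
    U.HasPattern U.P [0, 1] ∧
    U.HasPattern U.Q [1, 2] ∧
    U.HasPattern U.R [0, 2]) ∧
  (Even m → Odd n →
    U.HasPattern U.P [0, 1, 0, 2] ∧
    U.HasPattern U.Q [1, 2] ∧
    U.HasPattern U.R [0, 1, 0, 2]) ∧
  (∀ S ∈ U.extendedTriangleGroup, IsPlaneReflection S →
    ∃ g ∈ U.extendedTriangleGroup,
      S = g * U.P * g⁻¹ ∨ S = g * U.Q * g⁻¹ ∨ S = g * U.R * g⁻¹)

end UniversalMap

/-!
The proof rests on the fact that the images of the basic triangle `T` under `Γ(2, m, n)` do not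
overlap. To see it, `T` is described by three functions `f i`, one for each side: the signed
distance from the line carrying the side, or its hyperbolic sine, positive on `T`. Composed with
one of the reflections they change as simple roots do (`SideCoordinates.f_refl`). Tits' argument
then applies to words in `P`, `Q`, `R`: if multiplying `g` on the left by the reflection `i` does
not shorten it, then `f i ∘ g` is a nonnegative combination of the `f l`, by induction on the
length and by the explicit trigonometric formula in the dihedral group of a corner
(`SideCoordinates.exists_nonneg_of_isWord`). It follows that two points of the closed triangle in
one orbit are equal, and that the stabilizer of such a point is generated by the reflections in
the sides through it (`SideCoordinates.fixed_of_nonneg`). Hence a geometric point has one label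
and none lies inside a side.

The orbit of an interior point is uniformly separated, so every point of the plane has a nearest
point in it; therefore the images of `T` cover the plane (`SideCoordinates.exists_apply_nonneg`).
The mirror of any reflection in the group then contains a point that, moved into `T`, is not a
corner, and the stabilizer of such a point consists of the identity and at most one of `P`, `Q`,
`R`.

For the patterns, consider a mirror arriving at a corner whose dihedral group has order `2 * N`,
and the longest element of that group. If `N` is even, it is the half-turn, and the geometric
points on the mirror are symmetric about this corner. If `N` is odd, it exchanges the two lines at
the corner, and the mirror continues along the other kind of side
(`SideCoordinates.runsAlong_of_odd`). As `N = 2` at the edge-centres, each mirror runs between two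
corners of even order, through at most two corners of odd order; the half-turns at both ends make
the pattern periodic.

Both planes provide the functions `f i` as normalized determinants (`PlaneModel.sideCoordinates`).
In the hyperbolic plane these are determinants of the vectors `(|z| ^ 2, z.re, 1) / z.im`, whose
Lorentzian Gram matrices consist of the hyperbolic cosines of the distances. A reflection in the
line through `p` and `q` preserves distances from `p` and `q` and moves every point off the line,
so it changes the sign of `det p q`, and this determines it.
-/

/-! ### Words in the reflections -/

namespace UniversalMap

variable {X : Type*} [MetricSpace X] {angle : X → X → X → ℝ} {m n : ℕ}

/-- The corner with label `i` of the basic triangle. -/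
def vert (U : UniversalMap X angle m n) : Fin 3 → X := ![U.v0, U.v1, U.v2]

/-- The reflection in the side of the basic triangle opposite to the corner with label `i`. -/
def refl (U : UniversalMap X angle m n) : Fin 3 → X ≃ᵢ X := ![U.Q, U.R, U.P]

/-- The angle of the basic triangle at the corner with label `i` is `π / U.order i`. -/
def order (_ : UniversalMap X angle m n) : Fin 3 → ℕ := ![n, 2, m]

/-- Linear coordinates for the basic triangle. The function `f i` is a signed distance
(in the Euclidean plane) or its hyperbolic sine (in the hyperbolic plane) from the line that carries
the side opposite to the corner `i`, positive on the side of that corner; what is recorded are the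
properties through which the geometry of the plane enters the argument. The functions transform
under the reflections as the simple roots of a Coxeter group do (`f_refl_self`, `f_refl`). -/
structure SideCoordinates (U : UniversalMap X angle m n) where
  f : Fin 3 → X → ℝ
  continuous_f : ∀ i, Continuous (f i)
  f_vert_self : ∀ i, 0 < f i (U.vert i)
  f_vert : ∀ i j, i ≠ j → f i (U.vert j) = 0
  f_refl_self : ∀ i x, f i (U.refl i x) = -f i x
  f_refl : ∀ i j k, i ≠ j → j ≠ k → i ≠ k → ∀ x,
    f j (U.refl i x) = f j x + 2 * cos (π / U.order k) * f i x
  eq_of_proportional : ∀ x y c, (∀ i, f i x = c * f i y) → x = y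
  exists_interior : ∃ c, ∀ i, 0 < f i c
  dist_refl_lt : ∀ i c y, 0 < f i c → f i y < 0 → dist c (U.refl i y) < dist c y
  two_le_order : ∀ i, 2 ≤ U.order i

/-- `U.IsWord I k g` says that `g` is a product of `k` of the reflections `U.refl i`, `i ∈ I`. -/
inductive IsWord (U : UniversalMap X angle m n) (I : Set (Fin 3)) : ℕ → (X ≃ᵢ X) → Prop
  | one : IsWord U I 0 1
  | step (i : Fin 3) (hi : i ∈ I) (k : ℕ) (g : X ≃ᵢ X) (h : IsWord U I k g) :
      IsWord U I (k + 1) (U.refl i * g)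

/-- The alternating product `r i * r j * r i * ⋯` with `k` factors, where `r = U.refl`. -/
def alt (U : UniversalMap X angle m n) (i j : Fin 3) : ℕ → X ≃ᵢ X
  | 0 => 1
  | k + 1 => U.refl i * alt U j i k

theorem extendedTriangleGroup_eq (U : UniversalMap X angle m n) :
    U.extendedTriangleGroup = Subgroup.closure (Set.range U.refl) := by
  unfold extendedTriangleGroup
  congr 1
  ext g
  simp only [Set.mem_insert_iff, Set.mem_singleton_iff, Set.mem_range, Fin.exists_fin_succ, refl]
  simp
  tauto

theorem refl_mem (U : UniversalMap X angle m n) (i : Fin 3) :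
    U.refl i ∈ U.extendedTriangleGroup := by
  rw [U.extendedTriangleGroup_eq]
  exact Subgroup.subset_closure ⟨i, rfl⟩

theorem isPlaneReflection_refl (U : UniversalMap X angle m n) (i : Fin 3) :
    IsPlaneReflection (U.refl i) := by
  fin_cases i
  exacts [U.reflection_Q.1, U.reflection_R.1, U.reflection_P.1]

theorem refl_mul_self (U : UniversalMap X angle m n) (i : Fin 3) :
    U.refl i * U.refl i = 1 := (U.isPlaneReflection_refl i).1

theorem refl_mul_refl_mul (U : UniversalMap X angle m n) (i : Fin 3) (g : X ≃ᵢ X) :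
    U.refl i * (U.refl i * g) = g := by
  rw [← mul_assoc, U.refl_mul_self, one_mul]

theorem refl_refl (U : UniversalMap X angle m n) (i : Fin 3) (x : X) :
    U.refl i (U.refl i x) = x := by
  rw [← IsometryEquiv.mul_apply, U.refl_mul_self]
  rfl

theorem refl_inv (U : UniversalMap X angle m n) (i : Fin 3) :
    (U.refl i)⁻¹ = U.refl i := inv_eq_of_mul_eq_one_right (U.refl_mul_self i)

namespace IsWord

variable {U : UniversalMap X angle m n} {I J : Set (Fin 3)} {k l : ℕ} {g h : X ≃ᵢ X}

theorem mono (hIJ : I ⊆ J) (hg : U.IsWord I k g) : U.IsWord J k g := by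
  induction hg with
  | one => exact .one
  | step i hi k g _ ih => exact .step i (hIJ hi) k g ih

theorem mul (hg : U.IsWord I k g) (hh : U.IsWord I l h) : U.IsWord I (k + l) (g * h) := by
  induction hg with
  | one => simpa using hh
  | step i hi k g _ ih =>
    rw [mul_assoc, add_right_comm]
    exact .step i hi _ _ ih

theorem refl {i : Fin 3} (hi : i ∈ I) : U.IsWord I 1 (U.refl i) := by
  simpa using IsWord.step i hi 0 1 .one

theorem inv (hg : U.IsWord I k g) : U.IsWord I k g⁻¹ := by
  induction hg with
  | one => simpa using IsWord.one
  | step i hi k g _ ih =>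
    rw [mul_inv_rev, U.refl_inv]
    exact ih.mul (refl hi)

theorem mem (hg : U.IsWord I k g) : g ∈ U.extendedTriangleGroup := by
  induction hg with
  | one => exact one_mem _
  | step i hi k g _ ih => exact mul_mem (U.refl_mem i) ih

end IsWord

theorem exists_isWord (U : UniversalMap X angle m n) {g : X ≃ᵢ X}
    (hg : g ∈ U.extendedTriangleGroup) : ∃ k, U.IsWord Set.univ k g := by
  rw [U.extendedTriangleGroup_eq] at hg
  induction hg using Subgroup.closure_induction with
  | mem x hx =>
    obtain ⟨i, rfl⟩ := hx
    exact ⟨1, .refl (Set.mem_univ i)⟩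
  | one => exact ⟨0, .one⟩
  | mul x y _ _ hx hy =>
    obtain ⟨k, hk⟩ := hx
    obtain ⟨l, hl⟩ := hy
    exact ⟨_, hk.mul hl⟩
  | inv x _ hx =>
    obtain ⟨k, hk⟩ := hx
    exact ⟨k, hk.inv⟩

theorem isWord_alt (U : UniversalMap X angle m n) {I : Set (Fin 3)} {i j : Fin 3}
    (hi : i ∈ I) (hj : j ∈ I) (k : ℕ) : U.IsWord I k (U.alt i j k) := by
  induction k generalizing i j with
  | zero => exact .one
  | succ k ih => exact .step i hi k _ (ih hj hi)

theorem alt_add (U : UniversalMap X angle m n) {I : Set (Fin 3)} {i j : Fin 3}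
    (hi : i ∈ I) (hj : j ∈ I) (k l : ℕ) :
    ∃ g, U.IsWord I l g ∧ U.alt i j (k + l) = U.alt i j k * g := by
  induction k generalizing i j with
  | zero => exact ⟨_, U.isWord_alt hi hj l, by simp [alt]⟩
  | succ k ih =>
    obtain ⟨g, hg, e⟩ := ih hj hi
    refine ⟨g, hg, ?_⟩
    rw [add_right_comm, alt, alt, e, mul_assoc]

theorem alt_mem (U : UniversalMap X angle m n) (i j : Fin 3) (k : ℕ) :
    U.alt i j k ∈ U.extendedTriangleGroup :=
  (U.isWord_alt (Set.mem_univ i) (Set.mem_univ j) k).mem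

namespace SideCoordinates

variable {U : UniversalMap X angle m n}

theorem ext_f (F : U.SideCoordinates) {x y : X} (h : ∀ i, F.f i x = F.f i y) : x = y :=
  F.eq_of_proportional x y 1 (by simpa using h)

end SideCoordinates
end UniversalMap

namespace UniversalMap

variable {X : Type*} [MetricSpace X] {angle : X → X → X → ℝ} {m n : ℕ}

/-! ### Positivity of roots -/

namespace SideCoordinates

variable {U : UniversalMap X angle m n}

theorem order_pos (F : U.SideCoordinates) (k : Fin 3) : (0 : ℝ) < U.order k := by
  have := F.two_le_order k
  exact_mod_cast (by omega : 0 < U.order k)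

theorem sin_order_pos (F : U.SideCoordinates) (k : Fin 3) : 0 < sin (π / U.order k) := by
  have h2 : (2 : ℝ) ≤ U.order k := by exact_mod_cast F.two_le_order k
  have h := F.order_pos k
  apply sin_pos_of_pos_of_lt_pi (by positivity)
  rw [div_lt_iff₀ h]
  nlinarith [pi_pos]

theorem sin_mul_order_nonneg (F : U.SideCoordinates) (k : Fin 3) {p : ℕ} (hp : p ≤ U.order k) :
    0 ≤ sin (p * (π / U.order k)) := by
  have h := F.order_pos k
  have hp' : (p : ℝ) ≤ U.order k := by exact_mod_cast hp
  apply sin_nonneg_of_nonneg_of_le_pi (by positivity)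
  rw [mul_div_assoc', div_le_iff₀ h]
  nlinarith [pi_pos]

theorem sin_add_two_mul (p : ℕ) (θ : ℝ) :
    sin ((p + 2 : ℕ) * θ) = 2 * cos θ * sin ((p + 1 : ℕ) * θ) - sin (p * θ) := by
  have e1 : ((p + 2 : ℕ) : ℝ) * θ = ((p + 1 : ℕ) : ℝ) * θ + θ := by push_cast; ring
  have e2 : (p : ℝ) * θ = ((p + 1 : ℕ) : ℝ) * θ - θ := by push_cast; ring
  rw [e1, e2, sin_add, sin_sub]
  ring

/-- The roots of a dihedral group, written in terms of the two simple roots. -/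
theorem sin_mul_f_alt (F : U.SideCoordinates) {i j k : Fin 3} (hij : i ≠ j) (hik : i ≠ k)
    (hjk : j ≠ k) (p : ℕ) (x : X) :
    sin (π / U.order k) * F.f i (U.alt j i p x) =
      if Even p then
        sin ((p + 1 : ℕ) * (π / U.order k)) * F.f i x + sin (p * (π / U.order k)) * F.f j x
      else
        sin (p * (π / U.order k)) * F.f i x + sin ((p + 1 : ℕ) * (π / U.order k)) * F.f j x := by
  induction p using Nat.twoStepInduction generalizing i j with
  | zero => simp [alt]
  | one =>
    have h2 := sin_add_two_mul 0 (π / U.order k)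
    simp only [alt, mul_one, F.f_refl j i k hij.symm hik hjk]
    simp at h2 ⊢
    rw [h2]
    ring
  | more p ih1 ih2 =>
    have e1 := ih1 hij hik hjk
    have e2 := ih2 hij.symm hjk hik
    have s1 := sin_add_two_mul p (π / U.order k)
    have s2 := sin_add_two_mul (p + 1) (π / U.order k)
    rw [alt, IsometryEquiv.mul_apply, F.f_refl j i k hij.symm hik hjk]
    have e3 : F.f i (U.alt i j (p + 1) x) = -F.f i (U.alt j i p x) := by
      rw [alt, IsometryEquiv.mul_apply, F.f_refl_self]
    rw [e3]
    rw [show p + 2 + 1 = p + 1 + 2 from rfl, s2, s1]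
    rw [show p + 1 + 1 = p + 2 from rfl, s1] at e2
    rcases Nat.even_or_odd p with hp | hp
    · have h1 : ¬ Even (p + 1) := by simpa [Nat.even_add_one] using hp
      have h2 : Even (p + 2) := by simpa [Nat.even_add] using hp
      rw [if_pos hp] at e1
      rw [if_neg h1] at e2
      rw [if_pos h2]
      linear_combination -e1 + 2 * cos (π / U.order k) * e2
    · have hp' : ¬ Even p := Nat.not_even_iff_odd.2 hp
      have h1 : Even (p + 1) := by simpa [Nat.even_add_one] using hp
      have h2 : ¬ Even (p + 2) := by simpa [Nat.even_add] using hp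
      rw [if_neg hp'] at e1
      rw [if_pos h1] at e2
      rw [if_neg h2]
      linear_combination -e1 + 2 * cos (π / U.order k) * e2

/-- The alternating product of full length acts at the corner `k` as minus the identity, up to an
exchange of the two sides when `U.order k` is odd. -/
theorem f_alt_order (F : U.SideCoordinates) {i j k : Fin 3} (hij : i ≠ j) (hik : i ≠ k)
    (hjk : j ≠ k) (x : X) :
    F.f i (U.alt j i (U.order k) x) = if Even (U.order k) then -F.f i x else -F.f j x := by
  have h := F.sin_mul_f_alt hij hik hjk (U.order k) x
  have hs := F.sin_order_pos k
  have h0 := (F.order_pos k).ne'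
  have e1 : (U.order k : ℝ) * (π / U.order k) = π := by field_simp
  have e2 : ((U.order k + 1 : ℕ) : ℝ) * (π / U.order k) = π / U.order k + π := by
    push_cast; field_simp; ring
  rw [e1, e2, sin_pi, sin_add_pi] at h
  apply mul_left_cancel₀ hs.ne'
  rw [h]
  split_ifs <;> ring

/-- The companion of `f_alt_order` for the first letter of the product. -/
theorem f_alt_order' (F : U.SideCoordinates) {i j k : Fin 3} (hij : i ≠ j) (hik : i ≠ k)
    (hjk : j ≠ k) (x : X) :
    F.f j (U.alt j i (U.order k) x) = if Even (U.order k) then -F.f j x else -F.f i x := by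
  obtain ⟨p, hp⟩ : ∃ p, U.order k = p + 1 := ⟨U.order k - 1, by have := F.two_le_order k; omega⟩
  have h := F.sin_mul_f_alt hij.symm hjk hik p x
  have hs := F.sin_order_pos k
  have h0 := (F.order_pos k).ne'
  have hp' : (p : ℝ) = U.order k - 1 := by rw [hp]; push_cast; ring
  have e1 : ((p + 1 : ℕ) : ℝ) * (π / U.order k) = π := by rw [← hp]; field_simp
  have e2 : (p : ℝ) * (π / U.order k) = π - π / U.order k := by
    rw [hp']; field_simp
  rw [e1, e2, sin_pi, sin_pi_sub] at h
  have hA : U.alt j i (U.order k) = U.refl j * U.alt i j p := by rw [hp]; rfl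
  rw [hA, IsometryEquiv.mul_apply, F.f_refl_self]
  apply mul_left_cancel₀ hs.ne'
  rw [mul_neg, h, hp]
  simp only [Nat.even_add_one]
  split_ifs <;> ring

/-- A linear function that is invariant under the two reflections fixing the corner `k`. -/
theorem exists_invariant (F : U.SideCoordinates) {i j k : Fin 3} (hij : i ≠ j) (hik : i ≠ k)
    (hjk : j ≠ k) : ∃ a b : ℝ, ∀ x,
      F.f k (U.refl i x) + a * F.f i (U.refl i x) + b * F.f j (U.refl i x) =
        F.f k x + a * F.f i x + b * F.f j x ∧
      F.f k (U.refl j x) + a * F.f i (U.refl j x) + b * F.f j (U.refl j x) =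
        F.f k x + a * F.f i x + b * F.f j x := by
  have hd : 1 - cos (π / U.order k) ^ 2 ≠ 0 := by
    rw [← sin_sq]; exact pow_ne_zero _ (F.sin_order_pos k).ne'
  refine ⟨(cos (π / U.order j) + cos (π / U.order k) * cos (π / U.order i)) /
    (1 - cos (π / U.order k) ^ 2), (cos (π / U.order i) + cos (π / U.order k) *
    cos (π / U.order j)) / (1 - cos (π / U.order k) ^ 2), fun x => ⟨?_, ?_⟩⟩
  · rw [F.f_refl i k j hik hjk.symm hij, F.f_refl i j k hij hjk hik, F.f_refl_self]
    field_simp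
    ring
  · rw [F.f_refl j k i hjk hik.symm hij.symm, F.f_refl j i k hij.symm hik hjk, F.f_refl_self]
    field_simp
    ring

/-- The linear function of `exists_invariant` is invariant under the dihedral group at the
corner `k`. -/
theorem exists_invariant_alt (F : U.SideCoordinates) {i j k : Fin 3} (hij : i ≠ j) (hik : i ≠ k)
    (hjk : j ≠ k) : ∃ a b : ℝ, ∀ p x,
      (F.f k (U.alt i j p x) + a * F.f i (U.alt i j p x) + b * F.f j (U.alt i j p x) =
        F.f k x + a * F.f i x + b * F.f j x) ∧
      (F.f k (U.alt j i p x) + a * F.f i (U.alt j i p x) + b * F.f j (U.alt j i p x) =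
        F.f k x + a * F.f i x + b * F.f j x) := by
  obtain ⟨a, b, h⟩ := F.exists_invariant hij hik hjk
  refine ⟨a, b, fun p x => ?_⟩
  induction p with
  | zero => exact ⟨rfl, rfl⟩
  | succ p ih =>
    simp only [alt, IsometryEquiv.mul_apply]
    exact ⟨(h _).1.trans ih.2, (h _).2.trans ih.1⟩

theorem exists_third {i j : Fin 3} : i ≠ j → ∃ k, i ≠ k ∧ j ≠ k := by
  revert i j
  decide

theorem forall_fin_three {i j k : Fin 3} (hij : i ≠ j) (hik : i ≠ k) (hjk : j ≠ k)
    {p : Fin 3 → Prop} (hi : p i) (hj : p j) (hk : p k) (l : Fin 3) : p l := by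
  have : l = i ∨ l = j ∨ l = k := by omega
  rcases this with rfl | rfl | rfl <;> assumption

/-- The braid relation. -/
theorem alt_order_comm (F : U.SideCoordinates) {i j k : Fin 3} (hij : i ≠ j) (hik : i ≠ k)
    (hjk : j ≠ k) : U.alt i j (U.order k) = U.alt j i (U.order k) := by
  obtain ⟨a, b, h⟩ := F.exists_invariant_alt hij hik hjk
  ext x
  have h1 := F.f_alt_order hij hik hjk x
  have h2 := F.f_alt_order' hij hik hjk x
  have h3 := F.f_alt_order hij.symm hjk hik x
  have h4 := F.f_alt_order' hij.symm hjk hik x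
  have hi : F.f i (U.alt i j (U.order k) x) = F.f i (U.alt j i (U.order k) x) := by rw [h1, h4]
  have hj : F.f j (U.alt i j (U.order k) x) = F.f j (U.alt j i (U.order k) x) := by rw [h2, h3]
  refine F.ext_f (forall_fin_three hij hik hjk hi hj ?_)
  have h5 := (h (U.order k) x).1.trans (h (U.order k) x).2.symm
  rw [hi, hj] at h5
  linarith

/-- A shortest word in two letters alternates; here it cannot begin with the letter `i`. -/
theorem eq_alt_of_isWord {i j : Fin 3} (hij : i ≠ j) {p : ℕ}
    {g : X ≃ᵢ X} (hg : U.IsWord {i, j} p g)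
    (hmin : ∀ q, U.IsWord {i, j} q (U.refl i * g) → p ≤ q) : g = U.alt j i p := by
  induction p generalizing i j g with
  | zero => cases hg; rfl
  | succ p ih =>
    cases hg with
    | step l hl _ h hh =>
      rcases hl with rfl | rfl
      · have := hmin p (by rwa [U.refl_mul_refl_mul])
        omega
      · have e : ({i, l} : Set (Fin 3)) = {l, i} := Set.pair_comm _ _
        have e3 := ih hij.symm (e ▸ hh) (by
          intro q hq
          have := hmin (q + 1) (.step i (by simp) q _ (e ▸ hq))
          omega)
        rw [e3]
        rfl

/-- In a dihedral group, an element `g` that is not shortened by the reflection `i` pulls the root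
`i` back to a nonnegative combination of the two simple roots. -/
theorem exists_nonneg_of_isWord_pair (F : U.SideCoordinates) {i j : Fin 3} (hij : i ≠ j) {p : ℕ}
    {g : X ≃ᵢ X} (hg : U.IsWord {i, j} p g)
    (hmin : ∀ q, U.IsWord {i, j} q (U.refl i * g) → p ≤ q) :
    ∃ a b : ℝ, 0 ≤ a ∧ 0 ≤ b ∧ ∀ x, F.f i (g x) = a * F.f i x + b * F.f j x := by
  obtain ⟨k, hik, hjk⟩ : ∃ k, i ≠ k ∧ j ≠ k := exists_third hij
  obtain rfl := eq_alt_of_isWord hij hg hmin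
  have hp : p < U.order k := by
    -- By the braid relation, a word of full length could also begin with `i`.
    by_contra! hp
    obtain ⟨q, rfl⟩ := Nat.exists_eq_add_of_le hp
    obtain ⟨h, hh, e⟩ := U.alt_add (I := {i, j}) (i := j) (j := i) (by simp) (by simp)
      (U.order k) q
    obtain ⟨r, hr⟩ : ∃ r, U.order k = r + 1 :=
      ⟨U.order k - 1, by have := F.two_le_order k; omega⟩
    have e2 : U.refl i * U.alt j i (U.order k + q) = U.alt j i r * h := by
      rw [e, ← F.alt_order_comm hij hik hjk, hr, alt, mul_assoc, U.refl_mul_refl_mul]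
    have := hmin (r + q) (by
      rw [e2]
      exact (U.isWord_alt (by simp) (by simp) r).mul hh)
    omega
  have hs := F.sin_order_pos k
  have h1 := F.sin_mul_order_nonneg k hp.le
  have h2 := F.sin_mul_order_nonneg k (p := p + 1) hp
  have key := F.sin_mul_f_alt hij hik hjk p
  rcases Nat.even_or_odd p with he | ho
  · refine ⟨_, _, div_nonneg h2 hs.le, div_nonneg h1 hs.le, fun x => ?_⟩
    have := key x
    rw [if_pos he] at this
    rw [div_mul_eq_mul_div, div_mul_eq_mul_div, ← add_div, eq_div_iff hs.ne', mul_comm, this]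
  · refine ⟨_, _, div_nonneg h1 hs.le, div_nonneg h2 hs.le, fun x => ?_⟩
    have := key x
    rw [if_neg (Nat.not_even_iff_odd.2 ho)] at this
    rw [div_mul_eq_mul_div, div_mul_eq_mul_div, ← add_div, eq_div_iff hs.ne', mul_comm, this]

/-- If `g` has a word of length `p` and `U.refl i * g` has no shorter one, then `g` pulls the root
`i` back to a positive root. -/
theorem exists_nonneg_of_isWord (F : U.SideCoordinates) {i : Fin 3} {p : ℕ} {g : X ≃ᵢ X}
    (hg : U.IsWord Set.univ p g)
    (hmin : ∀ q, U.IsWord Set.univ q (U.refl i * g) → p ≤ q) :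
    ∃ a : Fin 3 → ℝ, (∀ l, 0 ≤ a l) ∧ ∀ x, F.f i (g x) = ∑ l, a l * F.f l x := by
  induction p using Nat.strong_induction_on generalizing i g with
  | _ p ih =>
  cases hg with
  | one => exact ⟨Pi.single i 1, fun l => by by_cases h : l = i <;> simp [h],
      fun x => by simp [Pi.single_apply]⟩
  | step j _ p g' hg' =>
    have hij : i ≠ j := by
      rintro rfl
      have := hmin p (by rwa [U.refl_mul_refl_mul])
      omega
    -- Split `g` as `u * v` with `u` in the dihedral group of `i` and `j`, without loss of length
    -- and with `v` as short as possible.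
    let A : Set ℕ := {b | ∃ u v a, U.refl j * g' = u * v ∧ U.IsWord {i, j} a u ∧
      U.IsWord Set.univ b v ∧ a + b ≤ p + 1}
    have hA : p ∈ A := ⟨U.refl j, g', 1, rfl, .refl (by simp), hg', by omega⟩
    classical
    have hex : ∃ b, b ∈ A := ⟨p, hA⟩
    obtain ⟨u, v, a, e, hu, hv, hab⟩ := Nat.find_spec hex
    have hmin' : ∀ q ∈ A, Nat.find hex ≤ q := fun q hq => Nat.find_min' hex hq
    generalize Nat.find hex = b at *
    have hbp := hmin' p hA
    have hstep : ∀ l ∈ ({i, j} : Set (Fin 3)), ∃ c : Fin 3 → ℝ, (∀ l, 0 ≤ c l) ∧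
        ∀ x, F.f l (v x) = ∑ t, c t * F.f t x := by
      intro l hl
      refine ih b (by omega) hv fun q hq => ?_
      by_contra! hlt
      refine absurd (hmin' q ⟨u * U.refl l, U.refl l * v, a + 1, ?_, hu.mul (.refl hl), hq,
        by omega⟩) (by omega)
      rw [e, mul_assoc, U.refl_mul_refl_mul]
    obtain ⟨c, d, hc, hd, hcd⟩ := F.exists_nonneg_of_isWord_pair hij hu (by
      intro q hq
      have := hmin (q + b) (by
        rw [e, ← mul_assoc]
        exact (hq.mono (Set.subset_univ _)).mul hv)
      omega)
    obtain ⟨ci, hci, hci'⟩ := hstep i (by simp)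
    obtain ⟨cj, hcj, hcj'⟩ := hstep j (by simp)
    refine ⟨fun l => c * ci l + d * cj l, fun l => ?_, fun x => ?_⟩
    · have := hci l; have := hcj l; positivity
    · rw [e, IsometryEquiv.mul_apply, hcd, hci', hcj']
      simp only [Finset.mul_sum, ← Finset.sum_add_distrib]
      exact Finset.sum_congr rfl fun l _ => by ring

/-! ### The basic triangle as a fundamental domain -/

theorem refl_eq_self_iff (F : U.SideCoordinates) (i : Fin 3) (x : X) :
    U.refl i x = x ↔ F.f i x = 0 := by
  constructor
  · intro h
    have := F.f_refl_self i x
    rw [h] at this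
    linarith
  · intro h
    refine F.ext_f fun j => ?_
    by_cases hj : j = i
    · rw [hj, F.f_refl_self, h, neg_zero]
    · obtain ⟨k, hik, hjk⟩ : ∃ k, i ≠ k ∧ j ≠ k := exists_third (Ne.symm hj)
      rw [F.f_refl i j k (Ne.symm hj) hjk hik, h, mul_zero, add_zero]

theorem mirror_refl (F : U.SideCoordinates) (i : Fin 3) :
    mirror (U.refl i) = {x | F.f i x = 0} :=
  Set.ext fun x => F.refl_eq_self_iff i x

/-- Two points of the closed basic triangle in one orbit are equal, and a group element that fixes
such a point is a product of reflections in sides through it. -/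
theorem fixed_of_nonneg (F : U.SideCoordinates) {p : ℕ} {g : X ≃ᵢ X}
    (hg : U.IsWord Set.univ p g) {x : X} (hx : ∀ i, 0 ≤ F.f i x) (hgx : ∀ i, 0 ≤ F.f i (g x)) :
    g x = x ∧ g ∈ Subgroup.closure (U.refl '' {i | F.f i x = 0}) := by
  induction p using Nat.strong_induction_on generalizing g with
  | _ p ih =>
  -- Only words of minimal length need an argument: then `g x` lies weakly on both sides of the
  -- mirror of the first letter, hence on it, and this letter can be dropped.
  by_cases hsh : ∃ q < p, U.IsWord Set.univ q g
  · obtain ⟨q, hq, h⟩ := hsh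
    exact ih q hq h hgx
  push Not at hsh
  cases hg with
  | one => exact ⟨rfl, one_mem _⟩
  | step i _ p h hh =>
    obtain ⟨a, ha, hfa⟩ := F.exists_nonneg_of_isWord (i := i) hh (by
      intro q hq
      by_contra! hlt
      exact hsh q (by omega) hq)
    have h1 : 0 ≤ F.f i (h x) := by
      rw [hfa]
      exact Finset.sum_nonneg fun l _ => mul_nonneg (ha l) (hx l)
    have h2 := hgx i
    rw [IsometryEquiv.mul_apply, F.f_refl_self] at h2
    have h3 : F.f i (h x) = 0 := by linarith
    have h4 : U.refl i (h x) = h x := (F.refl_eq_self_iff i _).2 h3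
    rw [IsometryEquiv.mul_apply, h4] at hgx
    obtain ⟨e, hm⟩ := ih p (by omega) hh hgx
    rw [IsometryEquiv.mul_apply, h4]
    refine ⟨e, mul_mem (Subgroup.subset_closure ⟨i, ?_, rfl⟩) hm⟩
    rwa [e] at h3

end SideCoordinates
end UniversalMap

/-! ### The orbit of the basic triangle -/

namespace UniversalMap

variable {X : Type*} [MetricSpace X] {angle : X → X → X → ℝ} {m n : ℕ}

theorem inv_apply_apply (g : X ≃ᵢ X) (x : X) : g⁻¹ (g x) = x :=
  IsometryEquiv.symm_apply_apply g x

theorem apply_inv_apply (g : X ≃ᵢ X) (x : X) : g (g⁻¹ x) = x :=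
  IsometryEquiv.apply_symm_apply g x

theorem mem_geometricPoints_iff (U : UniversalMap X angle m n) (a : Fin 3) (x : X) :
    x ∈ U.geometricPoints a ↔ ∃ g ∈ U.extendedTriangleGroup, x = g (U.vert a) := Iff.rfl

theorem apply_mem_geometricPoints_iff (U : UniversalMap X angle m n) {g : X ≃ᵢ X}
    (hg : g ∈ U.extendedTriangleGroup) (a : Fin 3) (x : X) :
    g x ∈ U.geometricPoints a ↔ x ∈ U.geometricPoints a := by
  simp only [mem_geometricPoints_iff]
  constructor
  · rintro ⟨h, hh, e⟩
    refine ⟨g⁻¹ * h, mul_mem (inv_mem hg) hh, ?_⟩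
    rw [IsometryEquiv.mul_apply, ← e]
    exact (inv_apply_apply g x).symm
  · rintro ⟨h, hh, rfl⟩
    exact ⟨g * h, mul_mem hg hh, rfl⟩

theorem countable_extendedTriangleGroup (U : UniversalMap X angle m n) :
    (U.extendedTriangleGroup : Set (X ≃ᵢ X)).Countable := by
  refine (Set.countable_range fun w : List (Fin 3) => (w.map U.refl).prod).mono ?_
  intro g hg
  obtain ⟨k, hk⟩ := U.exists_isWord hg
  clear hg
  induction hk with
  | one => exact ⟨[], rfl⟩
  | step i _ k g _ ih =>
    obtain ⟨w, rfl⟩ := ih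
    exact ⟨i :: w, by simp⟩

theorem countable_geometricPoints (U : UniversalMap X angle m n) (a : Fin 3) :
    (U.geometricPoints a).Countable := by
  refine (U.countable_extendedTriangleGroup.image fun g => g (U.vert a)).mono ?_
  rintro x ⟨g, hg, rfl⟩
  exact ⟨g, hg, rfl⟩

namespace SideCoordinates

variable {U : UniversalMap X angle m n}

theorem vert_nonneg (F : U.SideCoordinates) (a i : Fin 3) : 0 ≤ F.f i (U.vert a) := by
  by_cases h : i = a
  · rw [h]; exact (F.f_vert_self a).le
  · rw [F.f_vert i a h]

theorem vert_injective (F : U.SideCoordinates) : Function.Injective U.vert := by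
  intro a b h
  by_contra hab
  have h1 := F.f_vert_self a
  rw [h, F.f_vert a b hab] at h1
  exact h1.false

theorem eq_vert_of_eq_zero (F : U.SideCoordinates) {i j k : Fin 3} (hij : i ≠ j) (hik : i ≠ k)
    (hjk : j ≠ k) {x : X} (hi : F.f i x = 0) (hj : F.f j x = 0) : x = U.vert k := by
  have hk := (F.f_vert_self k).ne'
  refine F.eq_of_proportional _ _ (F.f k x / F.f k (U.vert k))
    (forall_fin_three hij hik hjk ?_ ?_ ?_)
  · rw [hi, F.f_vert i k hik, mul_zero]
  · rw [hj, F.f_vert j k hjk, mul_zero]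
  · field_simp

theorem refl_vert (F : U.SideCoordinates) {i k : Fin 3} (hik : i ≠ k) :
    U.refl i (U.vert k) = U.vert k :=
  (F.refl_eq_self_iff i _).2 (F.f_vert i k hik)

theorem alt_vert (F : U.SideCoordinates) {i j k : Fin 3} (hik : i ≠ k) (hjk : j ≠ k) (p : ℕ) :
    U.alt i j p (U.vert k) = U.vert k := by
  induction p generalizing i j with
  | zero => rfl
  | succ p ih => rw [alt, IsometryEquiv.mul_apply, ih hjk hik, F.refl_vert hik]

/-- The only geometric points in the closed basic triangle are its corners. -/
theorem eq_vert_of_mem_geometricPoints (F : U.SideCoordinates) {x : X} (hx : ∀ i, 0 ≤ F.f i x)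
    {a : Fin 3} (ha : x ∈ U.geometricPoints a) : x = U.vert a := by
  obtain ⟨g, hg, rfl⟩ := ha
  obtain ⟨k, hk⟩ := U.exists_isWord hg
  exact (F.fixed_of_nonneg hk (F.vert_nonneg a) hx).1

theorem vert_mem_geometricPoints_iff (F : U.SideCoordinates) (a b : Fin 3) :
    U.vert a ∈ U.geometricPoints b ↔ b = a := by
  constructor
  · intro h
    exact (F.vert_injective (F.eq_vert_of_mem_geometricPoints (F.vert_nonneg a) h)).symm
  · rintro rfl
    exact ⟨1, one_mem _, rfl⟩

/-- The orbit of an interior point of the basic triangle is uniformly separated, so that it has only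
finitely many points in every ball. -/
theorem finite_orbit_inter_closedBall [ProperSpace X] (F : U.SideCoordinates) {c : X}
    (hc : ∀ i, 0 < F.f i c) (x : X) (ρ : ℝ) :
    ({y | ∃ g ∈ U.extendedTriangleGroup, y = g c} ∩ Metric.closedBall x ρ).Finite := by
  have hopen : IsOpen {y | ∀ i, 0 < F.f i y} := by
    simp only [Set.ofPred_forall]
    exact isOpen_iInter_of_finite fun i => isOpen_lt continuous_const (F.continuous_f i)
  obtain ⟨r, hr, hball⟩ := Metric.isOpen_iff.1 hopen c hc
  obtain ⟨t, -, ht, hcov⟩ :=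
    (isCompact_closedBall x ρ).finite_cover_balls (half_pos hr)
  have hsub : ∀ z ∈ t, ({y | ∃ g ∈ U.extendedTriangleGroup, y = g c} ∩
      Metric.ball z (r / 2)).Finite := by
    intro z _
    apply Set.Subsingleton.finite
    rintro _ ⟨⟨g, hg, rfl⟩, h1⟩ _ ⟨⟨h, hh, rfl⟩, h2⟩
    rw [Metric.mem_ball] at h1 h2
    have hd : dist ((h⁻¹ * g) c) c < r := by
      have e : dist ((h⁻¹ * g) c) c = dist (g c) (h c) := by
        rw [← h.isometry.dist_eq, IsometryEquiv.mul_apply]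
        congr 1
        exact apply_inv_apply h (g c)
      rw [e]
      have := dist_triangle_right (g c) (h c) z
      linarith
    obtain ⟨k, hk⟩ := U.exists_isWord (mul_mem (inv_mem hh) hg)
    have := (F.fixed_of_nonneg hk (fun i => (hc i).le) (fun i => (hball hd i).le)).1
    have e := congrArg h this
    rw [IsometryEquiv.mul_apply] at e
    exact (apply_inv_apply h (g c)).symm.trans e
  refine (ht.biUnion hsub).subset ?_
  rintro y ⟨hy, hyb⟩
  obtain ⟨z, hz, hyz⟩ := Set.mem_iUnion₂.1 (hcov hyb)
  exact Set.mem_iUnion₂.2 ⟨z, hz, hy, hyz⟩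

/-- The images of the closed basic triangle cover the plane: a triangle whose image of a fixed
interior point is nearest to `x` contains `x`. -/
theorem exists_apply_nonneg [ProperSpace X] (F : U.SideCoordinates) (x : X) :
    ∃ g ∈ U.extendedTriangleGroup, ∀ i, 0 ≤ F.f i (g x) := by
  obtain ⟨c, hc⟩ := F.exists_interior
  obtain ⟨y, ⟨⟨g, hg, rfl⟩, hy⟩, hmin⟩ := Set.exists_min_image _ (fun y => dist y x)
    (F.finite_orbit_inter_closedBall hc x (dist c x)) ⟨c, ⟨1, one_mem _, rfl⟩, by simp⟩
  refine ⟨g⁻¹, inv_mem hg, fun i => ?_⟩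
  by_contra! hlt
  have h1 := F.dist_refl_lt i c _ (hc i) hlt
  have e1 : dist c (g⁻¹ x) = dist (g c) x := by
    rw [← g.isometry.dist_eq]
    congr 1
    exact apply_inv_apply g x
  have e2 : dist c (U.refl i (g⁻¹ x)) = dist ((g * U.refl i) c) x := by
    rw [← (g * U.refl i).isometry.dist_eq]
    congr 1
    rw [IsometryEquiv.mul_apply, U.refl_refl]
    exact apply_inv_apply g x
  rw [e1, e2] at h1
  rw [Metric.mem_closedBall] at hy
  exact absurd (hmin _ ⟨⟨g * U.refl i, mul_mem hg (U.refl_mem i), rfl⟩,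
    Metric.mem_closedBall.2 (h1.le.trans hy)⟩) (not_le.2 h1)

/-- A reflection fixes two corners of the basic triangle but not the third, whereas an isometry of a
line that fixes two points is the identity. -/
theorem not_isGeodesicLine_univ (F : U.SideCoordinates) :
    ¬ IsGeodesicLine (Set.univ : Set X) := by
  rintro ⟨γ, hγ, hr⟩
  have hsurj : ∀ x, ∃ t, γ t = x := fun x => by
    rw [← Set.mem_range, hr]; trivial
  obtain ⟨a, ha⟩ := hsurj (U.vert 1)
  obtain ⟨b, hb⟩ := hsurj (U.vert 2)
  obtain ⟨t, ht⟩ := hsurj (U.vert 0)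
  obtain ⟨u, hu⟩ := hsurj (U.refl 0 (U.vert 0))
  have key : ∀ {c : ℝ} {k : Fin 3}, 0 ≠ k → γ c = U.vert k → |u - c| = |t - c| := by
    intro c k hk hc
    rw [← Real.dist_eq, ← Real.dist_eq, ← hγ.dist_eq, ← hγ.dist_eq, hu, ht, hc,
      ← (U.refl 0).isometry.dist_eq (U.vert 0), F.refl_vert hk]
  have h1 := key (by decide) ha
  have h2 := key (by decide) hb
  have hab : a ≠ b := by
    rintro rfl
    exact absurd (F.vert_injective (ha.symm.trans hb)) (by decide)
  have hut : u = t := by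
    rcases abs_eq_abs.1 h1 with h1 | h1
    · linarith
    · rcases abs_eq_abs.1 h2 with h2 | h2
      · linarith
      · exact absurd (by linarith) hab
  rw [hut, ht] at hu
  exact (F.f_vert_self 0).ne' ((F.refl_eq_self_iff 0 _).1 hu.symm)

/-- A mirror contains a point that is not a corner of a triangle. Moved into the basic triangle, it
lies on at most one side, so that its stabilizer has at most one element besides the identity. -/
theorem exists_eq_conj_of_isPlaneReflection [ProperSpace X] (F : U.SideCoordinates) {S : X ≃ᵢ X}
    (hS : S ∈ U.extendedTriangleGroup) (hr : IsPlaneReflection S) :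
    ∃ g ∈ U.extendedTriangleGroup, ∃ i, S = g * U.refl i * g⁻¹ := by
  obtain ⟨γ, hγ, hrange⟩ := hr.2
  obtain ⟨t, ht⟩ : ∃ t, ∀ a, γ t ∉ U.geometricPoints a := by
    by_contra! h
    have hc : (⋃ a, γ ⁻¹' U.geometricPoints a).Countable :=
      Set.countable_iUnion fun a => (U.countable_geometricPoints a).preimage hγ.injective
    refine Cardinal.not_countable_real (hc.mono fun t _ => ?_)
    obtain ⟨a, ha⟩ := h t
    exact Set.mem_iUnion.2 ⟨a, ha⟩
  have hSt : S (γ t) = γ t := by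
    have : γ t ∈ mirror S := hrange ▸ Set.mem_range_self t
    exact this
  obtain ⟨g, hg, hgx⟩ := F.exists_apply_nonneg (γ t)
  have hfix : (g * S * g⁻¹) (g (γ t)) = g (γ t) := by
    have e : g⁻¹ (g (γ t)) = γ t := inv_apply_apply g _
    rw [IsometryEquiv.mul_apply, e, IsometryEquiv.mul_apply, hSt]
  obtain ⟨k, hk⟩ := U.exists_isWord (mul_mem (mul_mem hg hS) (inv_mem hg))
  have hmem := (F.fixed_of_nonneg hk hgx (by rwa [hfix])).2
  have hsub : {i | F.f i (g (γ t)) = 0}.Subsingleton := by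
    intro i hi j hj
    by_contra hij
    obtain ⟨l, hil, hjl⟩ := exists_third hij
    refine ht l ((U.apply_mem_geometricPoints_iff hg l _).1 ?_)
    rw [F.eq_vert_of_eq_zero hij hil hjl hi hj, F.vert_mem_geometricPoints_iff]
  have h1 : S ≠ 1 := by
    rintro rfl
    refine F.not_isGeodesicLine_univ ?_
    have e : mirror (1 : X ≃ᵢ X) = Set.univ := Set.eq_univ_of_forall fun _ => rfl
    exact e ▸ hr.2
  have h2 : g * S * g⁻¹ ≠ 1 := by
    intro h
    apply h1
    rw [mul_inv_eq_one] at h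
    simpa using h
  rcases hsub.eq_empty_or_singleton with h | ⟨i, h⟩
  · rw [h, Set.image_empty, Subgroup.closure_empty, Subgroup.mem_bot] at hmem
    exact absurd hmem h2
  · rw [h, Set.image_singleton, Subgroup.mem_closure_singleton] at hmem
    obtain ⟨z, hz⟩ := hmem
    refine ⟨g⁻¹, inv_mem hg, i, ?_⟩
    have hz' : U.refl i = g * S * g⁻¹ := by
      rw [← hz]
      rcases Int.even_or_odd' z with ⟨w, rfl | rfl⟩
      · exfalso
        apply h2
        rw [← hz, zpow_mul, zpow_ofNat, pow_two, U.refl_mul_self, one_zpow]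
      · rw [zpow_add, zpow_mul, zpow_ofNat, pow_two, U.refl_mul_self, one_zpow, one_mul, zpow_one]
    rw [hz']
    group

end SideCoordinates
end UniversalMap

/-! ### Mirrors and their patterns -/

namespace UniversalMap

variable {X : Type*} [MetricSpace X] {angle : X → X → X → ℝ} {m n : ℕ}

/-- A mirror has the pattern `link` as soon as the geometric points on it are periodic and those in
one period are labelled by `link`. -/
theorem mirrorHasPattern_of_periodic (U : UniversalMap X angle m n) {γ : ℝ → X} (hγ : Isometry γ)
    {link : List (Fin 3)} (hlink : link ≠ []) {l : ℝ} (hl : 0 < l)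
    (hper : ∀ s a, γ (s + l) ∈ U.geometricPoints a ↔ γ s ∈ U.geometricPoints a)
    (τ : ℕ → ℝ) (hτ0 : τ 0 = 0) (hτ : ∀ j, j + 1 < link.length → τ j < τ (j + 1))
    (hτl : τ (link.length - 1) < l)
    (honly : ∀ s, 0 ≤ s → s < l → ∀ a, γ s ∈ U.geometricPoints a → ∃ j < link.length, s = τ j)
    (hlab : ∀ (j : ℕ) (hj : j < link.length) (a : Fin 3),
      γ (τ j) ∈ U.geometricPoints a ↔ a = link[j]) :
    U.MirrorHasPattern (Set.range γ) link := by
  have hK : 0 < link.length := List.length_pos_iff.2 hlink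
  set K := link.length with hKdef
  have hK' : (0 : ℤ) < K := by exact_mod_cast hK
  have hperz : ∀ (q : ℤ) s a, γ (s + l * q) ∈ U.geometricPoints a ↔
      γ s ∈ U.geometricPoints a := by
    intro q s a
    induction q using Int.induction_on with
    | zero => simp
    | succ i ih =>
      rw [← ih, ← hper (s + l * (i : ℤ))]
      push_cast
      ring_nf
    | pred i ih =>
      rw [← ih, ← hper]
      push_cast
      ring_nf
  -- The `j`-th geometric point of the `q`-th period has the index `q * K + j`.
  let t : ℤ → ℝ := fun i => τ (i % K).toNat + l * (i / K : ℤ)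
  have ht : ∀ (q : ℤ) (j : ℕ), j < K → t (q * K + j) = τ j + l * q := by
    intro q j hj
    have e1 : (q * K + j) % (K : ℤ) = j := by
      rw [add_comm, Int.add_mul_emod_self_right]
      exact Int.emod_eq_of_lt (by omega) (by omega)
    have e2 : (q * K + j) / (K : ℤ) = q := by
      rw [add_comm, Int.add_mul_ediv_right _ _ hK'.ne',
        Int.ediv_eq_zero_of_lt (by omega) (by omega),
        zero_add]
    simp only [t, e1, e2, Int.toNat_natCast]
  have hdecomp : ∀ i : ℤ, ∃ (q : ℤ) (j : ℕ), j < K ∧ i = q * K + j := by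
    intro i
    have h1 := Int.emod_nonneg i hK'.ne'
    have h2 := Int.emod_lt_of_pos i hK'
    refine ⟨i / K, (i % K).toNat, by omega, ?_⟩
    rw [Int.toNat_of_nonneg h1]
    have := Int.mul_ediv_add_emod i K
    linarith
  have hmono : StrictMono t := by
    refine strictMono_int_of_lt_succ fun i => ?_
    obtain ⟨q, j, hj, rfl⟩ := hdecomp i
    rw [ht q j hj]
    by_cases hj' : j + 1 < K
    · have := ht q (j + 1) hj'
      push_cast at this
      rw [add_assoc, this]
      linarith [hτ j hj']
    · have e : (q * K + j + 1 : ℤ) = (q + 1) * K + (0 : ℕ) := by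
        have : (j : ℤ) + 1 = K := by omega
        push_cast
        linarith
      rw [e, ht _ 0 hK, hτ0]
      have : j = K - 1 := by omega
      rw [this]
      push_cast
      linarith
  have htK : ∀ q : ℤ, t (q * K) = l * q := by
    intro q
    have := ht q 0 hK
    rw [hτ0, zero_add] at this
    simpa using this
  refine ⟨γ, hγ, rfl, t, hmono, ?_, ?_, ?_, ?_⟩
  · refine tendsto_atTop_atTop_of_monotone hmono.monotone fun b => ?_
    obtain ⟨q, hq⟩ := exists_int_gt (b / l)
    refine ⟨q * K, ?_⟩
    rw [htK]
    rw [div_lt_iff₀ hl] at hq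
    linarith
  · refine tendsto_atBot_atBot_of_monotone hmono.monotone fun b => ?_
    obtain ⟨q, hq⟩ := exists_int_lt (b / l)
    refine ⟨q * K, ?_⟩
    rw [htK]
    rw [lt_div_iff₀ hl] at hq
    linarith
  · intro s
    constructor
    · rintro ⟨a, ha⟩
      have h1 := Int.floor_le (s / l)
      have h2 := Int.lt_floor_add_one (s / l)
      rw [le_div_iff₀ hl] at h1
      rw [div_lt_iff₀ hl] at h2
      set q := ⌊s / l⌋
      have e : s = (s - l * q) + l * q := by ring
      rw [e, hperz] at ha
      obtain ⟨j, hj, hsj⟩ := honly _ (by linarith) (by linarith) a ha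
      exact ⟨q * K + j, by rw [ht q j hj, ← hsj]; ring⟩
    · rintro ⟨i, rfl⟩
      obtain ⟨q, j, hj, rfl⟩ := hdecomp i
      exact ⟨link[j], by rw [ht q j hj, hperz, hlab j hj]⟩
  · intro q j a
    rw [ht q j j.2, hperz, hlab j j.2]
    rfl

/-- The last letter of a pattern may be moved to the front. -/
theorem MirrorHasPattern.rotate {U : UniversalMap X angle m n} {M : Set X} {link : List (Fin 3)}
    {x : Fin 3} (h : U.MirrorHasPattern M (link ++ [x])) : U.MirrorHasPattern M (x :: link) := by
  obtain ⟨γ, hγ, hM, t, hmono, htop, hbot, hiff, hlab⟩ := h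
  refine ⟨γ, hγ, hM, fun i => t (i - 1), fun i j hij => hmono (by simpa using hij),
    htop.comp (tendsto_atTop_add_const_right _ (-1) tendsto_id),
    hbot.comp (tendsto_atBot_add_const_right _ (-1) tendsto_id), fun s => ?_, ?_⟩
  · rw [hiff]
    constructor
    · rintro ⟨i, rfl⟩
      exact ⟨i + 1, by simp⟩
    · rintro ⟨i, rfl⟩
      exact ⟨i - 1, rfl⟩
  · rintro q ⟨j, hj⟩ a
    rcases j with _ | j
    · have := hlab (q - 1) ⟨link.length, by simp⟩ a
      simp only [Fin.getElem_fin, List.getElem_concat_length] at this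
      simp only [Fin.getElem_fin, List.getElem_cons_zero]
      rw [← this]
      simp only [List.length_append, List.length_cons, List.length_nil]
      congr! 3
      push_cast
      ring
    · have hj' : j < link.length := by simpa using hj
      have := hlab q ⟨j, by simp; omega⟩ a
      simp only [Fin.getElem_fin, List.getElem_append_left hj'] at this
      simp only [Fin.getElem_fin, List.getElem_cons_succ]
      rw [← this]
      simp only [List.length_append, List.length_cons, List.length_nil]
      congr! 3
      push_cast
      ring

/-- The line `γ` runs along the side opposite to the corner `j` of the triangle `g T`, where `T` is
the basic triangle, from the corner `i` at time `a` to the corner `k` at time `b`. -/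
structure RunsAlong (U : UniversalMap X angle m n) (γ : ℝ → X) (g : X ≃ᵢ X) (i k j : Fin 3)
    (a b : ℝ) : Prop where
  ik : i ≠ k
  ij : i ≠ j
  kj : k ≠ j
  isometry : Isometry γ
  mem : g ∈ U.extendedTriangleGroup
  range : Set.range γ = mirror (g * U.refl j * g⁻¹)
  lt : a < b
  start : γ a = g (U.vert i)
  finish : γ b = g (U.vert k)

theorem mem_mirror_conj (g S : X ≃ᵢ X) (x : X) :
    g x ∈ mirror (g * S * g⁻¹) ↔ x ∈ mirror S := by
  have e : g⁻¹ (g x) = x := inv_apply_apply g x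
  simp only [mirror, Set.mem_ofPred_eq, IsometryEquiv.mul_apply, e]
  exact g.injective.eq_iff

namespace SideCoordinates

variable {U : UniversalMap X angle m n}

theorem mem_mirror_conj_iff (F : U.SideCoordinates) (g : X ≃ᵢ X) (j : Fin 3) (x : X) :
    g x ∈ mirror (g * U.refl j * g⁻¹) ↔ F.f j x = 0 := by
  rw [mem_mirror_conj, F.mirror_refl]
  rfl

theorem exists_runsAlong (F : U.SideCoordinates) {i k j : Fin 3} (hik : i ≠ k) (hij : i ≠ j)
    (hkj : k ≠ j) {g : X ≃ᵢ X} (hg : g ∈ U.extendedTriangleGroup) :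
    ∃ γ d, U.RunsAlong γ g i k j 0 d := by
  obtain ⟨γ, hγ, hr⟩ := (U.isPlaneReflection_refl j).2
  rw [F.mirror_refl] at hr
  obtain ⟨a, ha⟩ : U.vert i ∈ Set.range γ := hr ▸ F.f_vert j i hij.symm
  obtain ⟨b, hb⟩ : U.vert k ∈ Set.range γ := hr ▸ F.f_vert j k hkj.symm
  have hab : a ≠ b := by
    rintro rfl
    exact hik (F.vert_injective (ha.symm.trans hb))
  -- The parameter is shifted to start at the corner `i` and, if need be, reversed.
  obtain ⟨ε, hε, hpos⟩ : ∃ ε : ℝ, ε * ε = 1 ∧ 0 < ε * (b - a) := by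
    rcases lt_or_gt_of_ne hab with h | h
    · exact ⟨1, by norm_num, by linarith⟩
    · exact ⟨-1, by norm_num, by linarith⟩
  refine ⟨fun s => g (γ (a + ε * s)), ε * (b - a), hik, hij, hkj, ?_, hg, ?_, hpos, ?_, ?_⟩
  · refine g.isometry.comp (hγ.comp (Isometry.of_dist_eq fun x y => ?_))
    have hε1 : |ε| = 1 := by
      have : |ε| * |ε| = 1 := by rw [← abs_mul, hε, abs_one]
      nlinarith [abs_nonneg ε]
    rw [Real.dist_eq, Real.dist_eq, show a + ε * x - (a + ε * y) = ε * (x - y) by ring, abs_mul,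
      hε1, one_mul]
  · ext x
    obtain ⟨y, rfl⟩ := g.surjective x
    rw [F.mem_mirror_conj_iff]
    change _ ↔ y ∈ {x | F.f j x = 0}
    rw [← hr]
    constructor
    · rintro ⟨s, hs⟩
      exact ⟨_, g.injective hs⟩
    · rintro ⟨s, rfl⟩
      refine ⟨ε * (s - a), ?_⟩
      simp only [← mul_assoc, hε, one_mul, add_sub_cancel]
  · simp [ha]
  · simp [← mul_assoc, hε, hb]

/-- On a mirror through the corner `i`, the other side through that corner cuts off a half-line. -/
theorem f_pos_of_notMem_uIcc (F : U.SideCoordinates) {γ : ℝ → X} (hγ : Isometry γ) {i k j : Fin 3}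
    (hik : i ≠ k) (hij : i ≠ j) (hkj : k ≠ j) (hr : ∀ s, F.f j (γ s) = 0) {a b s : ℝ}
    (ha : γ a = U.vert i) (hb : 0 < F.f k (γ b)) (hs : a ∉ Set.uIcc s b) : 0 < F.f k (γ s) := by
  by_contra! hle
  have hc : ContinuousOn (fun u => F.f k (γ u)) (Set.uIcc s b) :=
    ((F.continuous_f k).comp hγ.continuous).continuousOn
  obtain ⟨u, hu, hu0⟩ := intermediate_value_uIcc hc (Set.mem_uIcc_of_le hle hb.le)
  have := F.eq_vert_of_eq_zero hkj hik.symm hij.symm hu0 (hr u)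
  rw [← ha] at this
  exact hs (hγ.injective this ▸ hu)

theorem f_inv_apply (F : U.SideCoordinates) {γ : ℝ → X} {g : X ≃ᵢ X} {i k j : Fin 3} {a b : ℝ}
    (h : U.RunsAlong γ g i k j a b) (s : ℝ) : F.f j (g⁻¹ (γ s)) = 0 := by
  have : γ s ∈ mirror (g * U.refl j * g⁻¹) := h.range ▸ Set.mem_range_self s
  rwa [← apply_inv_apply g (γ s), F.mem_mirror_conj_iff] at this

theorem start_mem_geometricPoints_iff (F : U.SideCoordinates) {γ : ℝ → X} {g : X ≃ᵢ X}
    {i k j : Fin 3} {a b : ℝ} (h : U.RunsAlong γ g i k j a b) (c : Fin 3) :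
    γ a ∈ U.geometricPoints c ↔ c = i := by
  rw [h.start, U.apply_mem_geometricPoints_iff h.mem, F.vert_mem_geometricPoints_iff]

theorem finish_mem_geometricPoints_iff (F : U.SideCoordinates) {γ : ℝ → X} {g : X ≃ᵢ X}
    {i k j : Fin 3} {a b : ℝ} (h : U.RunsAlong γ g i k j a b) (c : Fin 3) :
    γ b ∈ U.geometricPoints c ↔ c = k := by
  rw [h.finish, U.apply_mem_geometricPoints_iff h.mem, F.vert_mem_geometricPoints_iff]

/-- There are no geometric points in the interior of a side. -/
theorem notMem_geometricPoints (F : U.SideCoordinates) {γ : ℝ → X} {g : X ≃ᵢ X}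
    {i k j : Fin 3} {a b : ℝ} (h : U.RunsAlong γ g i k j a b) {s : ℝ} (has : a < s) (hsb : s < b)
    (c : Fin 3) : γ s ∉ U.geometricPoints c := by
  intro hc
  have hγ : Isometry fun s => g⁻¹ (γ s) := (g⁻¹).isometry.comp h.isometry
  have ha : g⁻¹ (γ a) = U.vert i := by rw [h.start, inv_apply_apply]
  have hb : g⁻¹ (γ b) = U.vert k := by rw [h.finish, inv_apply_apply]
  have hk : 0 < F.f k (g⁻¹ (γ s)) := by
    refine F.f_pos_of_notMem_uIcc hγ h.ik h.ij h.kj (F.f_inv_apply h) ha (b := b) ?_ ?_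
    · rw [hb]; exact F.f_vert_self k
    · rw [Set.uIcc_of_le hsb.le]; exact fun hh => absurd hh.1 (not_le.2 has)
  have hi : 0 < F.f i (g⁻¹ (γ s)) := by
    refine F.f_pos_of_notMem_uIcc hγ h.ik.symm h.kj h.ij (F.f_inv_apply h) hb (b := a) ?_ ?_
    · rw [ha]; exact F.f_vert_self i
    · rw [Set.uIcc_of_ge has.le]; exact fun hh => absurd hh.2 (not_le.2 hsb)
  have hj : F.f j (g⁻¹ (γ s)) = 0 := F.f_inv_apply h s
  rw [← apply_inv_apply g (γ s), U.apply_mem_geometricPoints_iff h.mem] at hc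
  have e := F.eq_vert_of_mem_geometricPoints
    (forall_fin_three h.ik h.ij h.kj hi.le hk.le hj.ge) hc
  have key : ∀ l, l ≠ c → F.f l (g⁻¹ (γ s)) = 0 := fun l hl => by rw [e, F.f_vert l c hl]
  by_cases hic : i = c
  · exact hk.ne' (key k (hic ▸ h.ik.symm))
  · exact hi.ne' (key i hic)

/-- At a corner of even order a mirror is invariant under a half-turn. -/
theorem geometricPoints_symm_of_even (F : U.SideCoordinates) {γ : ℝ → X} (hγ : Isometry γ)
    {g : X ≃ᵢ X} (hg : g ∈ U.extendedTriangleGroup) {i k j : Fin 3} (hik : i ≠ k) (hij : i ≠ j)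
    (hkj : k ≠ j) (hr : Set.range γ = mirror (g * U.refl j * g⁻¹)) (he : Even (U.order i)) {a : ℝ}
    (ha : γ a = g (U.vert i)) (s : ℝ) (c : Fin 3) :
    γ (2 * a - s) ∈ U.geometricPoints c ↔ γ s ∈ U.geometricPoints c := by
  set w := U.alt j k (U.order i)
  have hw : g * w * g⁻¹ ∈ U.extendedTriangleGroup :=
    mul_mem (mul_mem hg (U.alt_mem _ _ _)) (inv_mem hg)
  have hwi : w (U.vert i) = U.vert i := F.alt_vert hij.symm hik.symm _
  have hf : ∀ u, F.f j (g⁻¹ (γ u)) = 0 := by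
    intro u
    have : γ u ∈ mirror (g * U.refl j * g⁻¹) := hr ▸ Set.mem_range_self u
    rwa [← apply_inv_apply g (γ u), F.mem_mirror_conj_iff] at this
  suffices h : (g * w * g⁻¹) (γ s) = γ (2 * a - s) by
    rw [← h, U.apply_mem_geometricPoints_iff hw]
  have hmem : (g * w * g⁻¹) (γ s) ∈ Set.range γ := by
    rw [hr, IsometryEquiv.mul_apply, IsometryEquiv.mul_apply, F.mem_mirror_conj_iff,
      F.f_alt_order' hkj hik.symm hij.symm, if_pos he, hf, neg_zero]
  obtain ⟨u, hu⟩ := hmem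
  have hd : |u - a| = |s - a| := by
    have e : (g * w * g⁻¹) (γ a) = γ a := by
      rw [IsometryEquiv.mul_apply, IsometryEquiv.mul_apply, ha, inv_apply_apply, hwi]
    rw [← Real.dist_eq, ← Real.dist_eq, ← hγ.dist_eq, ← hγ.dist_eq, hu, ← e,
      (g * w * g⁻¹).isometry.dist_eq, e]
  rw [← hu]
  congr 1
  -- The half-turn changes the sign of `f k`, so it does not fix `γ s` unless `s = a`.
  rcases abs_eq_abs.1 hd with h | h
  · have hus : u = s := by linarith
    have h1 : F.f k (g⁻¹ (γ s)) = -F.f k (g⁻¹ (γ s)) := by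
      conv_lhs => rw [← hus, hu]
      rw [IsometryEquiv.mul_apply, IsometryEquiv.mul_apply, inv_apply_apply,
        F.f_alt_order hkj hik.symm hij.symm, if_pos he]
    have h2 := F.eq_vert_of_eq_zero hkj hik.symm hij.symm (by linarith) (hf s)
    have h3 : s = a := by
      apply hγ.injective
      rw [ha, ← h2, apply_inv_apply]
    linarith
  · linarith

/-- The full alternating product at a corner of odd order exchanges the mirrors of the two sides
there. -/
theorem mirror_conj_eq_of_odd (F : U.SideCoordinates) {g : X ≃ᵢ X} {i k j : Fin 3}
    (hik : i ≠ k) (hij : i ≠ j) (hkj : k ≠ j) (ho : Odd (U.order k)) :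
    mirror ((g * U.alt i j (U.order k)) * U.refl i * (g * U.alt i j (U.order k))⁻¹) =
      mirror (g * U.refl j * g⁻¹) := by
  ext x
  obtain ⟨y, rfl⟩ := (g * U.alt i j (U.order k)).surjective x
  rw [F.mem_mirror_conj_iff, IsometryEquiv.mul_apply, F.mem_mirror_conj_iff,
    F.f_alt_order hij.symm hkj.symm hik, if_neg (Nat.not_even_iff_odd.2 ho), neg_eq_zero]

/-- At a corner of odd order a mirror passes from one side of a triangle to the other side, at that
corner, of the opposite triangle. -/
theorem runsAlong_of_odd (F : U.SideCoordinates) {γ : ℝ → X} {g : X ≃ᵢ X}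
    {i k j : Fin 3} {a b : ℝ} (h : U.RunsAlong γ g i k j a b) (ho : Odd (U.order k)) :
    ∃ g' b', U.RunsAlong γ g' k j i b b' := by
  have ho' := Nat.not_even_iff_odd.2 ho
  set w := U.alt i j (U.order k) with hw
  have hwk : w (U.vert k) = U.vert k := F.alt_vert h.ik h.kj.symm _
  have hγ : Isometry fun s => g⁻¹ (γ s) := (g⁻¹).isometry.comp h.isometry
  have ha : g⁻¹ (γ a) = U.vert i := by rw [h.start, inv_apply_apply]
  have hb : g⁻¹ (γ b) = U.vert k := by rw [h.finish, inv_apply_apply]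
  have hmir := F.mirror_conj_eq_of_odd (g := g) h.ik h.ij h.kj ho
  obtain ⟨c, hc⟩ : g (w (U.vert j)) ∈ Set.range γ := by
    rw [h.range, F.mem_mirror_conj_iff, F.f_alt_order h.ij.symm h.kj.symm h.ik, if_neg ho',
      F.f_vert i j h.ij, neg_zero]
  have hneg : F.f i (g⁻¹ (γ c)) < 0 := by
    rw [hc, inv_apply_apply, F.f_alt_order' h.ij.symm h.kj.symm h.ik, if_neg ho']
    exact neg_neg_of_pos (F.f_vert_self j)
  have hbc : b ∈ Set.uIcc c a := by
    by_contra hn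
    refine hneg.not_gt (F.f_pos_of_notMem_uIcc hγ h.ik.symm h.kj h.ij (F.f_inv_apply h) hb ?_ hn)
    rw [ha]
    exact F.f_vert_self i
  have hlt : b < c := by
    have h1 : b ≠ c := by
      rintro rfl
      rw [hb, F.f_vert i k h.ik] at hneg
      exact hneg.false
    rcases Set.mem_uIcc.1 hbc with ⟨h2, h3⟩ | ⟨h2, h3⟩
    · exact absurd h3 (not_le.2 h.lt)
    · exact lt_of_le_of_ne h3 h1
  exact ⟨g * w, c, h.kj, h.ik.symm, h.ij.symm, h.isometry, mul_mem h.mem (U.alt_mem _ _ _),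
    h.range.trans hmir.symm, hlt, by rw [IsometryEquiv.mul_apply, hwk, h.finish], hc⟩

theorem hasPattern_of_odd (F : U.SideCoordinates) {i k j : Fin 3} (hik : i ≠ k) (hij : i ≠ j)
    (hkj : k ≠ j) (ho : Odd (U.order k)) {link : List (Fin 3)}
    (h : U.HasPattern (U.refl i) link) : U.HasPattern (U.refl j) link := by
  intro g hg
  have := h _ (mul_mem hg (U.alt_mem i j (U.order k)))
  rwa [F.mirror_conj_eq_of_odd hik hij hkj ho] at this

theorem symm_start_of_even (F : U.SideCoordinates) {γ : ℝ → X} {g : X ≃ᵢ X} {i k j : Fin 3}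
    {a b : ℝ} (h : U.RunsAlong γ g i k j a b) (he : Even (U.order i)) (s : ℝ) (c : Fin 3) :
    γ (2 * a - s) ∈ U.geometricPoints c ↔ γ s ∈ U.geometricPoints c :=
  F.geometricPoints_symm_of_even h.isometry h.mem h.ik h.ij h.kj h.range he h.start s c

theorem symm_finish_of_even (F : U.SideCoordinates) {γ : ℝ → X} {g : X ≃ᵢ X} {i k j : Fin 3}
    {a b : ℝ} (h : U.RunsAlong γ g i k j a b) (he : Even (U.order k)) (s : ℝ) (c : Fin 3) :
    γ (2 * b - s) ∈ U.geometricPoints c ↔ γ s ∈ U.geometricPoints c :=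
  F.geometricPoints_symm_of_even h.isometry h.mem h.ik.symm h.kj h.ij h.range he h.finish s c

/-- The two half-turns at the times `0` and `L` compose to a translation by `2 * L`. -/
theorem periodic_of_symm {γ : ℝ → X} {L : ℝ}
    (h0 : ∀ s c, γ (2 * 0 - s) ∈ U.geometricPoints c ↔ γ s ∈ U.geometricPoints c)
    (hL : ∀ s c, γ (2 * L - s) ∈ U.geometricPoints c ↔ γ s ∈ U.geometricPoints c) (s : ℝ)
    (c : Fin 3) : γ (s + 2 * L) ∈ U.geometricPoints c ↔ γ s ∈ U.geometricPoints c := by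
  rw [← hL, ← h0 s]
  ring_nf

/-- A mirror that meets corners of even order at both ends of a side. -/
theorem hasPattern_of_even_even (F : U.SideCoordinates) {i k j : Fin 3} (hik : i ≠ k) (hij : i ≠ j)
    (hkj : k ≠ j) (hi : Even (U.order i)) (hk : Even (U.order k)) :
    U.HasPattern (U.refl j) [i, k] := by
  intro g hg
  obtain ⟨γ, d, h⟩ := F.exists_runsAlong hik hij hkj hg
  have h0 := F.symm_start_of_even h hi
  have hL := F.symm_finish_of_even h hk
  have hd := h.lt
  rw [← h.range]
  refine U.mirrorHasPattern_of_periodic h.isometry (by simp) (l := 2 * d) (by linarith)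
    (periodic_of_symm h0 hL) (fun j => if j = 0 then 0 else d) rfl ?_ ?_ ?_ ?_
  · intro p hp
    simp at hp
    subst hp
    simpa using hd
  · simp; linarith
  · intro s hs0 hsl c hc
    rcases hs0.eq_or_lt with rfl | hs0
    · exact ⟨0, by simp, rfl⟩
    rcases lt_trichotomy s d with hs | rfl | hs
    · exact absurd hc (F.notMem_geometricPoints h hs0 hs c)
    · exact ⟨1, by simp, rfl⟩
    · rw [← hL] at hc
      exact absurd hc (F.notMem_geometricPoints h (by linarith) (by linarith) c)
  · intro p hp c
    have : p < 2 := hp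
    interval_cases p
    · exact F.start_mem_geometricPoints_iff h c
    · exact F.finish_mem_geometricPoints_iff h c

/-- A mirror that meets, in this order, corners of even, odd and even order. -/
theorem hasPattern_of_even_odd_even (F : U.SideCoordinates) {i k j : Fin 3} (hik : i ≠ k)
    (hij : i ≠ j) (hkj : k ≠ j) (hi : Even (U.order i)) (hk : Odd (U.order k))
    (hj : Even (U.order j)) : U.HasPattern (U.refl j) [i, k, j, k] := by
  intro g hg
  obtain ⟨γ, d, h⟩ := F.exists_runsAlong hik hij hkj hg
  obtain ⟨g', L, h'⟩ := F.runsAlong_of_odd h hk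
  have h0 := F.symm_start_of_even h hi
  have hL := F.symm_finish_of_even h' hj
  have hd := h.lt
  have hd' := h'.lt
  rw [← h.range]
  refine U.mirrorHasPattern_of_periodic h.isometry (by simp) (l := 2 * L) (by linarith)
    (periodic_of_symm h0 hL)
    (fun j => if j = 0 then 0 else if j = 1 then d else if j = 2 then L else 2 * L - d) rfl
    ?_ ?_ ?_ ?_
  · intro p hp
    have : p + 1 < 4 := hp
    have : p < 3 := by omega
    interval_cases p <;> simp <;> linarith
  · simp; linarith
  · have key : ∀ s, 0 < s → s < L → ∀ c, γ s ∈ U.geometricPoints c → s = d := by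
      intro s hs0 hsL c hc
      rcases lt_trichotomy s d with hs | rfl | hs
      · exact absurd hc (F.notMem_geometricPoints h hs0 hs c)
      · rfl
      · exact absurd hc (F.notMem_geometricPoints h' hs hsL c)
    intro s hs0 hsl c hc
    rcases hs0.eq_or_lt with rfl | hs0
    · exact ⟨0, by simp, rfl⟩
    rcases lt_trichotomy s L with hs | rfl | hs
    · exact ⟨1, by simp, key s hs0 hs c hc⟩
    · exact ⟨2, by simp, rfl⟩
    · rw [← hL] at hc
      have := key _ (by linarith) (by linarith) c hc
      exact ⟨3, by simp, by simp; linarith⟩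
  · intro p hp c
    have : p < 4 := hp
    interval_cases p
    · exact F.start_mem_geometricPoints_iff h c
    · exact F.finish_mem_geometricPoints_iff h c
    · exact F.finish_mem_geometricPoints_iff h' c
    · exact (hL d c).trans (F.finish_mem_geometricPoints_iff h c)

/-- A mirror that meets, between two corners of even order, two corners of odd order. -/
theorem hasPattern_of_even_odd_odd (F : U.SideCoordinates) {i k j : Fin 3} (hik : i ≠ k)
    (hij : i ≠ j) (hkj : k ≠ j) (hi : Even (U.order i)) (hk : Odd (U.order k))
    (hj : Odd (U.order j)) : U.HasPattern (U.refl j) [i, k, j, i, j, k] := by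
  intro g hg
  obtain ⟨γ, d, h⟩ := F.exists_runsAlong hik hij hkj hg
  obtain ⟨g', e, h'⟩ := F.runsAlong_of_odd h hk
  obtain ⟨g'', L, h''⟩ := F.runsAlong_of_odd h' hj
  have h0 := F.symm_start_of_even h hi
  have hL := F.symm_finish_of_even h'' hi
  have hd := h.lt
  have hd' := h'.lt
  have hd'' := h''.lt
  rw [← h.range]
  refine U.mirrorHasPattern_of_periodic h.isometry (by simp) (l := 2 * L) (by linarith)
    (periodic_of_symm h0 hL)
    (fun j => if j = 0 then 0 else if j = 1 then d else if j = 2 then e else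
      if j = 3 then L else if j = 4 then 2 * L - e else 2 * L - d) rfl
    ?_ ?_ ?_ ?_
  · intro p hp
    have : p + 1 < 6 := hp
    have : p < 5 := by omega
    interval_cases p <;> simp <;> linarith
  · simp; linarith
  · have key : ∀ s, 0 < s → s < L → ∀ c, γ s ∈ U.geometricPoints c → s = d ∨ s = e := by
      intro s hs0 hsL c hc
      rcases lt_trichotomy s d with hs | rfl | hs
      · exact absurd hc (F.notMem_geometricPoints h hs0 hs c)
      · exact .inl rfl
      rcases lt_trichotomy s e with hs' | rfl | hs'
      · exact absurd hc (F.notMem_geometricPoints h' hs hs' c)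
      · exact .inr rfl
      · exact absurd hc (F.notMem_geometricPoints h'' hs' hsL c)
    intro s hs0 hsl c hc
    rcases hs0.eq_or_lt with rfl | hs0
    · exact ⟨0, by simp, rfl⟩
    rcases lt_trichotomy s L with hs | rfl | hs
    · rcases key s hs0 hs c hc with hh | hh
      · exact ⟨1, by simp, hh⟩
      · exact ⟨2, by simp, hh⟩
    · exact ⟨3, by simp, rfl⟩
    · rw [← hL] at hc
      rcases key _ (by linarith) (by linarith) c hc with hh | hh
      · exact ⟨5, by simp, by simp; linarith⟩
      · exact ⟨4, by simp, by simp; linarith⟩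
  · intro p hp c
    have : p < 6 := hp
    interval_cases p
    · exact F.start_mem_geometricPoints_iff h c
    · exact F.finish_mem_geometricPoints_iff h c
    · exact F.finish_mem_geometricPoints_iff h' c
    · exact F.finish_mem_geometricPoints_iff h'' c
    · exact (hL e c).trans (F.finish_mem_geometricPoints_iff h' c)
    · exact (hL d c).trans (F.finish_mem_geometricPoints_iff h c)

/-- The corner with label `1` has order `2`, so the parities of the other two orders decide at which
corners a mirror is reflected onto itself and at which it changes the kind of side. -/
theorem patternTable [ProperSpace X] (F : U.SideCoordinates) : U.PatternTable := by
  have h1 : Even (U.order 1) := even_two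
  refine ⟨fun hm hn => ?_, fun hm hn => ?_, fun hm hn => ?_, fun hm hn => ?_, fun S hS hr => ?_⟩
  · have h0 : Odd (U.order 0) := hn
    have h2 : Odd (U.order 2) := hm
    have hP : U.HasPattern (U.refl 2) [0, 1, 0, 2, 1, 2] := fun g hg =>
      MirrorHasPattern.rotate (link := [1, 0, 2, 1, 2])
        (F.hasPattern_of_even_odd_odd (i := 1) (k := 0) (j := 2) (by decide) (by decide)
          (by decide) h1 h0 h2 g hg)
    have hR : U.HasPattern (U.refl 1) [0, 1, 0, 2, 1, 2] :=
      F.hasPattern_of_odd (i := 2) (k := 0) (j := 1) (by decide) (by decide) (by decide) h0 hP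
    exact ⟨hP,
      F.hasPattern_of_odd (i := 1) (k := 2) (j := 0) (by decide) (by decide) (by decide) h2 hR, hR⟩
  · have h0 : Even (U.order 0) := hn
    have h2 : Odd (U.order 2) := hm
    have hR : U.HasPattern (U.refl 1) [0, 2, 1, 2] :=
      F.hasPattern_of_even_odd_even (i := 0) (k := 2) (j := 1)
        (by decide) (by decide) (by decide) h0 h2 h1
    exact ⟨F.hasPattern_of_even_even (i := 0) (k := 1) (j := 2)
        (by decide) (by decide) (by decide) h0 h1,
      F.hasPattern_of_odd (i := 1) (k := 2) (j := 0) (by decide) (by decide) (by decide) h2 hR, hR⟩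
  · have h0 : Even (U.order 0) := hn
    have h2 : Even (U.order 2) := hm
    exact ⟨F.hasPattern_of_even_even (i := 0) (k := 1) (j := 2)
        (by decide) (by decide) (by decide) h0 h1,
      F.hasPattern_of_even_even (i := 1) (k := 2) (j := 0)
        (by decide) (by decide) (by decide) h1 h2,
      F.hasPattern_of_even_even (i := 0) (k := 2) (j := 1)
        (by decide) (by decide) (by decide) h0 h2⟩
  · have h0 : Odd (U.order 0) := hn
    have h2 : Even (U.order 2) := hm
    have hP : U.HasPattern (U.refl 2) [0, 1, 0, 2] := fun g hg =>
      MirrorHasPattern.rotate (link := [1, 0, 2])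
        (F.hasPattern_of_even_odd_even (i := 1) (k := 0) (j := 2) (by decide) (by decide)
          (by decide) h1 h0 h2 g hg)
    exact ⟨hP, F.hasPattern_of_even_even (i := 1) (k := 2) (j := 0)
         (by decide) (by decide) (by decide) h1 h2,
      F.hasPattern_of_odd (i := 2) (k := 0) (j := 1) (by decide) (by decide) (by decide) h0 hP⟩
  · obtain ⟨g, hg, i, rfl⟩ := F.exists_eq_conj_of_isPlaneReflection hS hr
    refine ⟨g, hg, ?_⟩
    fin_cases i
    · exact .inr (.inl rfl)
    · exact .inr (.inr rfl)
    · exact .inl rfl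

end SideCoordinates
end UniversalMap

/-! ### Side coordinates from plane geometry -/

/-- What is used of the analytic geometry of the Euclidean and of the hyperbolic plane: an
alternating function `det`, whose zeros `x ↦ det p q x` form the line through `p` and `q`, and a
function `len` of the distance of two points such that `x ↦ det p q x / len p q` is the signed
distance from that line, or its hyperbolic sine. -/
structure PlaneModel (X : Type*) [MetricSpace X] (angle : X → X → X → ℝ) where
  det : X → X → X → ℝ
  len : X → X → ℝ
  angle_comm : ∀ q p r, angle q p r = angle r p q
  det_swap : ∀ p q r, det q p r = -det p q r
  det_rotate : ∀ p q r, det q r p = det p q r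
  len_comm : ∀ p q, len p q = len q p
  len_pos : ∀ p q, p ≠ q → 0 < len p q
  continuous_det : ∀ p q, Continuous (det p q)
  det_ne_zero : ∀ p q r, q ≠ p → r ≠ p → angle q p r = π / 2 → det p q r ≠ 0
  eq_of_proportional : ∀ p q r, det p q r ≠ 0 → ∀ x y c, det q r x = c * det q r y →
    det r p x = c * det r p y → det p q x = c * det p q y → x = y
  exists_interior : ∀ p q r, ∃ c t, 0 < t ∧ det q r c = t * det p q r ∧
    det r p c = t * det p q r ∧ det p q c = t * det p q r
  det_refl_self : ∀ (S : X ≃ᵢ X) p q, p ≠ q → IsReflectionIn S p q → ∀ x,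
    det p q (S x) = -det p q x
  det_refl : ∀ (S : X ≃ᵢ X) p q r, p ≠ q → p ≠ r → IsReflectionIn S p q → ∀ x,
    det p r (S x) / len p r = det p r x / len p r - 2 * cos (angle q p r) * (det p q x / len p q)
  dist_refl_lt : ∀ (S : X ≃ᵢ X) p q, p ≠ q → IsReflectionIn S p q → ∀ c y,
    det p q c * det p q y < 0 → dist c (S y) < dist c y

namespace PlaneModel

variable {X : Type*} [MetricSpace X] {angle : X → X → X → ℝ}

theorem det_self_left (M : PlaneModel X angle) (p q : X) : M.det p q p = 0 := by
  have := M.det_swap p p q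
  rw [M.det_rotate]
  linarith

theorem det_self_right (M : PlaneModel X angle) (p q : X) : M.det p q q = 0 := by
  rw [M.det_swap q p, M.det_self_left, neg_zero]

/-- The signed distance from the line through `p` and `q`, or its hyperbolic sine; the sign
is normalized by `σ`. -/
noncomputable def sideForm (M : PlaneModel X angle) (σ : ℝ) (p q x : X) : ℝ :=
  σ * (M.det p q x / M.len p q)

theorem sideForm_swap (M : PlaneModel X angle) (σ : ℝ) (p q x : X) :
    M.sideForm σ q p x = -M.sideForm σ p q x := by
  rw [sideForm, sideForm, M.det_swap, M.len_comm q p]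
  ring

theorem sideForm_left (M : PlaneModel X angle) (σ : ℝ) (p q : X) : M.sideForm σ p q p = 0 := by
  rw [sideForm, M.det_self_left, zero_div, mul_zero]

theorem sideForm_right (M : PlaneModel X angle) (σ : ℝ) (p q : X) : M.sideForm σ p q q = 0 := by
  rw [sideForm, M.det_self_right, zero_div, mul_zero]

theorem sideForm_refl_self (M : PlaneModel X angle) (σ : ℝ) {S : X ≃ᵢ X} {p q : X} (hpq : p ≠ q)
    (hS : IsReflectionIn S p q) (x : X) : M.sideForm σ p q (S x) = -M.sideForm σ p q x := by
  rw [sideForm, sideForm, M.det_refl_self S p q hpq hS]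
  ring

theorem sideForm_refl_left (M : PlaneModel X angle) (σ : ℝ) {S : X ≃ᵢ X} {p q r : X} (hpq : p ≠ q)
    (hpr : p ≠ r) (hS : IsReflectionIn S p q) (x : X) :
    M.sideForm σ r p (S x) = M.sideForm σ r p x + 2 * cos (angle q p r) * M.sideForm σ p q x := by
  rw [M.sideForm_swap, M.sideForm_swap σ p r x]
  unfold sideForm
  rw [M.det_refl S p q r hpq hpr hS]
  ring

theorem sideForm_refl_right (M : PlaneModel X angle) (σ : ℝ) {S : X ≃ᵢ X} {p q r : X} (hpq : p ≠ q)
    (hqr : q ≠ r) (hS : IsReflectionIn S p q) (x : X) :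
    M.sideForm σ q r (S x) = M.sideForm σ q r x + 2 * cos (angle p q r) * M.sideForm σ p q x := by
  have h : IsReflectionIn S q p := ⟨hS.1, hS.2.2, hS.2.1⟩
  have := M.sideForm_refl_left σ hpq.symm hqr h x
  rw [M.sideForm_swap, M.sideForm_swap σ q r x, M.sideForm_swap σ p q x] at this
  linarith

theorem dist_refl_lt_of_sideForm (M : PlaneModel X angle) {σ : ℝ} {S : X ≃ᵢ X} {p q : X}
    (hpq : p ≠ q) (hS : IsReflectionIn S p q) {c y : X} (hc : 0 < M.sideForm σ p q c)
    (hy : M.sideForm σ p q y < 0) : dist c (S y) < dist c y := by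
  refine M.dist_refl_lt S p q hpq hS c y ?_
  have hl := M.len_pos p q hpq
  have h := mul_neg_of_pos_of_neg hc hy
  have e : M.sideForm σ p q c * M.sideForm σ p q y =
      (σ / M.len p q) ^ 2 * (M.det p q c * M.det p q y) := by
    unfold sideForm
    field_simp
  rw [e] at h
  exact neg_of_mul_neg_right h (sq_nonneg _)

/-- The side coordinates of a universal map that is drawn in a plane model. -/
noncomputable def sideCoordinates (M : PlaneModel X angle) {m n : ℕ} (hm : 2 ≤ m) (hn : 2 ≤ n)
    (U : UniversalMap X angle m n) : U.SideCoordinates :=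
  have hD : M.det U.v0 U.v1 U.v2 ≠ 0 := by
    have := M.det_ne_zero U.v1 U.v0 U.v2 U.v0_ne_v1 U.v1_ne_v2.symm U.angle_v1
    rwa [M.det_swap, neg_ne_zero] at this
  let σ := M.det U.v0 U.v1 U.v2
  have h01 := U.v0_ne_v1
  have h12 := U.v1_ne_v2
  have h02 := U.v0_ne_v2
  have hQ := U.reflection_Q
  have hP := U.reflection_P
  have hR : IsReflectionIn U.R U.v2 U.v0 :=
    ⟨U.reflection_R.1, U.reflection_R.2.2, U.reflection_R.2.1⟩
  have l01 := M.len_pos _ _ h01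
  have l12 := M.len_pos _ _ h12
  have l20 := M.len_pos _ _ h02.symm
  have a1 : angle U.v0 U.v1 U.v2 = π / (2 : ℕ) := by rw [U.angle_v1]; norm_num
  have a1' : angle U.v2 U.v1 U.v0 = π / (2 : ℕ) := by rw [M.angle_comm, a1]
  have a0' : angle U.v2 U.v0 U.v1 = π / n := by rw [M.angle_comm, U.angle_v0]
  have a2' : angle U.v0 U.v2 U.v1 = π / m := by rw [M.angle_comm, U.angle_v2]
  { f := ![M.sideForm (σ / |σ|) U.v1 U.v2, M.sideForm (σ / |σ|) U.v2 U.v0,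
      M.sideForm (σ / |σ|) U.v0 U.v1]
    continuous_f := by
      intro i
      fin_cases i <;>
      exact continuous_const.mul ((M.continuous_det _ _).div_const _)
    f_vert_self := by
      have hσ : 0 < σ / |σ| * σ := by
        rw [div_mul_eq_mul_div]
        exact div_pos (mul_self_pos.2 hD) (abs_pos.2 hD)
      intro i
      fin_cases i
      · change 0 < σ / |σ| * (M.det U.v1 U.v2 U.v0 / _)
        rw [M.det_rotate, mul_div_assoc']
        exact div_pos hσ l12
      · change 0 < σ / |σ| * (M.det U.v2 U.v0 U.v1 / _)
        rw [M.det_rotate, M.det_rotate, mul_div_assoc']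
        exact div_pos hσ l20
      · change 0 < σ / |σ| * (M.det U.v0 U.v1 U.v2 / _)
        rw [mul_div_assoc']
        exact div_pos hσ l01
    f_vert := by
      intro i j hij
      fin_cases i <;> fin_cases j <;>
      first
      | exact absurd rfl hij
      | exact M.sideForm_left _ _ _
      | exact M.sideForm_right _ _ _
    f_refl_self := by
      intro i
      fin_cases i
      · exact M.sideForm_refl_self _ h12 hQ
      · exact M.sideForm_refl_self _ h02.symm hR
      · exact M.sideForm_refl_self _ h01 hP
    f_refl := by
      intro i j k hij hjk hik
      fin_cases i <;> fin_cases j <;> fin_cases k <;> first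
      | exact absurd rfl hij
      | exact absurd rfl hjk
      | exact absurd rfl hik
      | skip
      · exact fun x => (M.sideForm_refl_right _ h12 h02.symm hQ x).trans (by rw [U.angle_v2]; rfl)
      · exact fun x => (M.sideForm_refl_left _ h12 h01.symm hQ x).trans (by rw [a1']; rfl)
      · exact fun x => (M.sideForm_refl_left _ h02.symm h12.symm hR x).trans (by rw [a2']; rfl)
      · exact fun x => (M.sideForm_refl_right _ h02.symm h01 hR x).trans (by rw [a0']; rfl)
      · exact fun x => (M.sideForm_refl_right _ h01 h12 hP x).trans (by rw [a1]; rfl)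
      · exact fun x => (M.sideForm_refl_left _ h01 h02 hP x).trans (by rw [U.angle_v0]; rfl)
    eq_of_proportional := by
      have hσ : σ / |σ| ≠ 0 := div_ne_zero hD (abs_pos.2 hD).ne'
      have key : ∀ {p q x y : X} {c : ℝ}, 0 < M.len p q →
          M.sideForm (σ / |σ|) p q x = c * M.sideForm (σ / |σ|) p q y →
          M.det p q x = c * M.det p q y := by
        intro p q x y c hl h
        unfold sideForm at h
        have h' : (σ / |σ| / M.len p q) * M.det p q x =
            (σ / |σ| / M.len p q) * (c * M.det p q y) := by
          linear_combination h
        exact mul_left_cancel₀ (div_ne_zero hσ hl.ne') h'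
      intro x y c h
      exact M.eq_of_proportional U.v0 U.v1 U.v2 hD x y c (key l12 (h 0)) (key l20 (h 1))
        (key l01 (h 2))
    exists_interior := by
      have hσ : 0 < σ / |σ| * σ := by
        rw [div_mul_eq_mul_div]
        exact div_pos (mul_self_pos.2 hD) (abs_pos.2 hD)
      obtain ⟨c, t, ht, e0, e1, e2⟩ := M.exists_interior U.v0 U.v1 U.v2
      have key : ∀ {p q : X}, 0 < M.len p q → M.det p q c = t * σ →
          0 < M.sideForm (σ / |σ|) p q c := by
        intro p q hl h
        rw [sideForm, h]
        have : σ / |σ| * (t * σ / M.len p q) = (σ / |σ| * σ) * t / M.len p q := by ring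
        rw [this]
        positivity
      refine ⟨c, fun i => ?_⟩
      fin_cases i
      exacts [key l12 e0, key l20 e1, key l01 e2]
    dist_refl_lt := by
      intro i c y hc hy
      fin_cases i
      · exact M.dist_refl_lt_of_sideForm h12 hQ hc hy
      · exact M.dist_refl_lt_of_sideForm h02.symm hR hc hy
      · exact M.dist_refl_lt_of_sideForm h01 hP hc hy
    two_le_order := by
      intro i
      fin_cases i
      exacts [hn, le_rfl, hm] }

end PlaneModel

/-! ### The Euclidean plane -/

namespace EuclideanModel

/-- Twice the signed area of a triangle. -/
def det (p q x : ℂ) : ℝ :=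
  (q.re - p.re) * (x.im - p.im) - (q.im - p.im) * (x.re - p.re)

/-- The inner product of `q - p` and `r - p`. -/
def dot (p q r : ℂ) : ℝ :=
  (q.re - p.re) * (r.re - p.re) + (q.im - p.im) * (r.im - p.im)

theorem dist_sq (p q : ℂ) : dist p q ^ 2 = (q.re - p.re) ^ 2 + (q.im - p.im) ^ 2 := by
  rw [Complex.dist_eq_re_im, Real.sq_sqrt (by positivity)]
  ring

theorem dot_eq (p q r : ℂ) : dot p q r = (dist p q ^ 2 + dist p r ^ 2 - dist q r ^ 2) / 2 := by
  rw [dist_sq, dist_sq, dist_sq, dot]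
  ring

theorem det_sq (p q r : ℂ) : det p q r ^ 2 = dist p q ^ 2 * dist p r ^ 2 - dot p q r ^ 2 := by
  rw [dist_sq, dist_sq, dot, det]
  ring

theorem cos_angle_mul (q p r : ℂ) :
    cos (EuclideanGeometry.angle q p r) * (dist p q * dist p r) = dot p q r := by
  have h := InnerProductGeometry.cos_angle_mul_norm_mul_norm (q - p) (r - p)
  rw [dist_comm p q, dist_comm p r, dist_eq_norm, dist_eq_norm]
  refine h.trans ?_
  rw [Complex.inner]
  simp [dot]
  ring

/-- Points of a line are collinear. -/
theorem det_eq_zero_of_isGeodesicLine {L : Set ℂ} (hL : IsGeodesicLine L) {p q x : ℂ} (hp : p ∈ L)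
    (hq : q ∈ L) (hx : x ∈ L) : det p q x = 0 := by
  obtain ⟨γ, hγ, rfl⟩ := hL
  obtain ⟨a, rfl⟩ := hp
  obtain ⟨b, rfl⟩ := hq
  obtain ⟨c, rfl⟩ := hx
  have h := det_sq (γ a) (γ b) (γ c)
  rw [dot_eq, hγ.dist_eq, hγ.dist_eq, hγ.dist_eq, Real.dist_eq, Real.dist_eq, Real.dist_eq, sq_abs,
    sq_abs, sq_abs] at h
  rw [← sq_eq_zero_iff, h]
  ring

/-- A reflection preserves the coordinate along its line. -/
theorem dot_refl {S : ℂ ≃ᵢ ℂ} {p q : ℂ} (hS : IsReflectionIn S p q) (x : ℂ) :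
    dot p q (S x) = dot p q x := by
  have h1 : dist p (S x) = dist p x := by
    conv_lhs => rw [← hS.2.1, S.isometry.dist_eq]
  have h2 : dist q (S x) = dist q x := by
    conv_lhs => rw [← hS.2.2, S.isometry.dist_eq]
  rw [dot_eq, dot_eq, h1, h2]

theorem det_refl_self {S : ℂ ≃ᵢ ℂ} {p q : ℂ} (hpq : p ≠ q) (hS : IsReflectionIn S p q) (x : ℂ) :
    det p q (S x) = -det p q x := by
  have h1 : dist p (S x) = dist p x := by
    conv_lhs => rw [← hS.2.1, S.isometry.dist_eq]
  have h2 := dot_refl hS x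
  have hd : 0 < dist p q := dist_pos.2 hpq
  have hsq : det p q (S x) ^ 2 = det p q x ^ 2 := by rw [det_sq, det_sq, h1, h2]
  rcases sq_eq_sq_iff_eq_or_eq_neg.1 hsq with h | h
  · -- Otherwise `x` would be fixed, hence on the line.
    have e : dist p q ^ 2 * dist x (S x) ^ 2 = 0 := by
      have : dist p q ^ 2 * dist x (S x) ^ 2 =
          (det p q (S x) - det p q x) ^ 2 + (dot p q (S x) - dot p q x) ^ 2 := by
        rw [dist_sq, dist_sq, det, det, dot, dot]
        ring
      rw [this, h, h2]
      ring
    have hx : S x = x := by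
      rcases mul_eq_zero.1 e with e | e
      · exact absurd e (pow_pos hd 2).ne'
      · exact (dist_eq_zero.1 (pow_eq_zero_iff two_ne_zero |>.1 e)).symm
    have := det_eq_zero_of_isGeodesicLine hS.1.2 (p := p) (q := q) (x := x) hS.2.1 hS.2.2 hx
    rw [hx, this, neg_zero]
  · exact h

theorem det_refl {S : ℂ ≃ᵢ ℂ} {p q r : ℂ} (hpq : p ≠ q) (hpr : p ≠ r) (hS : IsReflectionIn S p q)
    (x : ℂ) : det p r (S x) / dist p r = det p r x / dist p r -
      2 * cos (EuclideanGeometry.angle q p r) * (det p q x / dist p q) := by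
  have hd : 0 < dist p q := dist_pos.2 hpq
  have hd' : 0 < dist p r := dist_pos.2 hpr
  have h1 := det_refl_self hpq hS x
  have h2 := dot_refl hS x
  have h3 := cos_angle_mul q p r
  -- `y - p` in the orthogonal basis of `q - p` and its normal, paired with the normal of `r - p`
  have key : ∀ y, dist p q ^ 2 * det p r y = dot p q y * det p r q + det p q y * dot p q r := by
    intro y
    rw [dist_sq, det, det, det, dot, dot]
    ring
  have k1 := key (S x)
  have k2 := key x
  rw [h1, h2] at k1
  have k3 : dist p q ^ 2 * det p r (S x) = dist p q ^ 2 * det p r x -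
      2 * det p q x * (cos (EuclideanGeometry.angle q p r) * (dist p q * dist p r)) := by
    rw [h3]
    linarith
  field_simp
  apply mul_left_cancel₀ hd.ne'
  linear_combination k3

theorem dist_refl_lt {S : ℂ ≃ᵢ ℂ} {p q : ℂ} (hpq : p ≠ q) (hS : IsReflectionIn S p q) (c y : ℂ)
    (h : det p q c * det p q y < 0) : dist c (S y) < dist c y := by
  have hd : 0 < dist p q := dist_pos.2 hpq
  have h1 := det_refl_self hpq hS y
  have h2 := dot_refl hS y
  have key : ∀ z, dist p q ^ 2 * dist c z ^ 2 =
      (det p q z - det p q c) ^ 2 + (dot p q z - dot p q c) ^ 2 := by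
    intro z
    rw [dist_sq, dist_sq, det, det, dot, dot]
    ring
  have k1 := key (S y)
  have k2 := key y
  rw [h1, h2] at k1
  have h3 : dist p q ^ 2 * dist c (S y) ^ 2 < dist p q ^ 2 * dist c y ^ 2 := by nlinarith
  exact lt_of_pow_lt_pow_left₀ 2 dist_nonneg (lt_of_mul_lt_mul_left h3 (by positivity))

theorem eq_of_proportional {p q r : ℂ} (hD : det p q r ≠ 0) {x y : ℂ} {c : ℝ}
    (h0 : det q r x = c * det q r y) (h1 : det r p x = c * det r p y)
    (h2 : det p q x = c * det p q y) : x = y := by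
  have hsum : ∀ z, det q r z + det r p z + det p q z = det p q r := by
    intro z
    simp only [det]
    ring
  have hc : c = 1 := by
    apply mul_right_cancel₀ hD
    linear_combination hsum x - c * hsum y - h0 - h1 - h2
  subst hc
  have hre : ∀ z : ℂ, det p q r * z.re =
      det q r z * p.re + det r p z * q.re + det p q z * r.re := by
    intro z
    simp only [det]
    ring
  have him : ∀ z : ℂ, det p q r * z.im =
      det q r z * p.im + det r p z * q.im + det p q z * r.im := by
    intro z
    simp only [det]
    ring
  apply Complex.ext <;> apply mul_left_cancel₀ hD
  · rw [hre, hre, h0, h1, h2]; ring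
  · rw [him, him, h0, h1, h2]; ring

/-- The Euclidean plane. -/
noncomputable def model : PlaneModel ℂ EuclideanGeometry.angle where
  det := det
  len := dist
  angle_comm := EuclideanGeometry.angle_comm
  det_swap p q r := by simp only [det]; ring
  det_rotate p q r := by simp only [det]; ring
  len_comm := dist_comm
  len_pos p q h := dist_pos.2 h
  continuous_det p q := by unfold det; fun_prop
  det_ne_zero p q r hq hr h := by
    have h1 := cos_angle_mul q p r
    rw [h, cos_pi_div_two, zero_mul] at h1
    have h2 := det_sq p q r
    rw [← h1] at h2
    have := dist_pos.2 hq.symm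
    have := dist_pos.2 hr.symm
    intro h0
    rw [h0] at h2
    have : 0 < dist p q ^ 2 * dist p r ^ 2 := by positivity
    linarith
  eq_of_proportional p q r hD x y c := eq_of_proportional hD
  exists_interior p q r := by
    -- the centroid
    refine ⟨⟨(p.re + q.re + r.re) / 3, (p.im + q.im + r.im) / 3⟩, 1 / 3, by norm_num,
      ?_, ?_, ?_⟩ <;>
    · simp only [det]; ring
  det_refl_self S p q hpq hS x := det_refl_self hpq hS x
  det_refl S p q r hpq hpr hS x := det_refl hpq hpr hS x
  dist_refl_lt S p q hpq hS c y := dist_refl_lt hpq hS c y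

end EuclideanModel

/-! ### The hyperbolic plane -/

namespace HyperbolicModel

/-- The first of the coordinates `(|z| ^ 2, z.re, 1) / z.im`, which map the upper half-plane onto a
sheet of the hyperboloid `A * C - B ^ 2 = 1`. -/
noncomputable def hA (z : ℍ) : ℝ := (z.re ^ 2 + z.im ^ 2) / z.im

/-- The second hyperboloid coordinate. -/
noncomputable def hB (z : ℍ) : ℝ := z.re / z.im

/-- The third hyperboloid coordinate. -/
noncomputable def hC (z : ℍ) : ℝ := 1 / z.im

/-- Half the determinant of the vectors of three points. -/
noncomputable def det (p q r : ℍ) : ℝ :=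
  (hA p * (hB q * hC r - hC q * hB r) - hB p * (hA q * hC r - hC q * hA r) +
    hC p * (hA q * hB r - hB q * hA r)) / 2

theorem hC_pos (z : ℍ) : 0 < hC z := one_div_pos.2 z.im_pos

theorem hA_mul_hC (z : ℍ) : hA z * hC z = hB z ^ 2 + 1 := by
  have := z.im_pos.ne'
  unfold hA hB hC
  field_simp

/-- The hyperbolic cosine of the distance is the polar form of `A * C - B ^ 2`. -/
theorem cosh_dist_eq (z w : ℍ) :
    cosh (dist z w) = (hA z * hC w + hC z * hA w - 2 * hB z * hB w) / 2 := by
  have hz := z.im_pos.ne'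
  have hw := w.im_pos.ne'
  rw [UpperHalfPlane.cosh_dist']
  unfold hA hB hC
  field_simp
  ring

theorem sinh_dist_pos {p q : ℍ} (h : p ≠ q) : 0 < sinh (dist p q) :=
  sinh_pos_iff.2 (dist_pos.2 h)

/-- The Gram determinant of three points. -/
theorem det_sq (p q r : ℍ) : det p q r ^ 2 =
    1 + 2 * cosh (dist p q) * cosh (dist p r) * cosh (dist q r) - cosh (dist p q) ^ 2 -
      cosh (dist p r) ^ 2 - cosh (dist q r) ^ 2 := by
  have hp := hA_mul_hC p
  have hq := hA_mul_hC q
  have hr := hA_mul_hC r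
  have key : det p q r ^ 2 = (hA p * hC p - hB p ^ 2) * (hA q * hC q - hB q ^ 2) *
      (hA r * hC r - hB r ^ 2) + 2 * cosh (dist p q) * cosh (dist p r) * cosh (dist q r) -
      cosh (dist p q) ^ 2 * (hA r * hC r - hB r ^ 2) -
      cosh (dist p r) ^ 2 * (hA q * hC q - hB q ^ 2) -
      cosh (dist q r) ^ 2 * (hA p * hC p - hB p ^ 2) := by
    rw [cosh_dist_eq, cosh_dist_eq, cosh_dist_eq, det]
    ring
  rw [key, hp, hq, hr]
  ring

/-- The expansion of `x` in the basis given by `p`, `q` and the normal of their plane, paired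
with `z`. -/
theorem sinh_sq_mul_cosh_dist (p q x z : ℍ) :
    sinh (dist p q) ^ 2 * cosh (dist x z) =
      (cosh (dist p q) * cosh (dist q x) - cosh (dist p x)) * cosh (dist p z) +
      (cosh (dist p q) * cosh (dist p x) - cosh (dist q x)) * cosh (dist q z) -
      det p q x * det p q z := by
  have hp := hA_mul_hC p
  have hq := hA_mul_hC q
  have key : (cosh (dist p q) ^ 2 - (hA p * hC p - hB p ^ 2) * (hA q * hC q - hB q ^ 2)) *
      cosh (dist x z) =
      (cosh (dist p q) * cosh (dist q x) - (hA q * hC q - hB q ^ 2) * cosh (dist p x)) *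
        cosh (dist p z) +
      (cosh (dist p q) * cosh (dist p x) - (hA p * hC p - hB p ^ 2) * cosh (dist q x)) *
        cosh (dist q z) - det p q x * det p q z := by
    simp only [cosh_dist_eq, det]
    ring
  rw [hp, hq] at key
  rw [sinh_sq]
  linear_combination key

/-- The same expansion, paired with the normal of the plane of `p` and `r`. -/
theorem sinh_sq_mul_det (p q r x : ℍ) :
    sinh (dist p q) ^ 2 * det p r x =
      (cosh (dist p q) * cosh (dist p x) - cosh (dist q x)) * det p r q -
      det p q x * (cosh (dist q r) - cosh (dist p q) * cosh (dist p r)) := by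
  have hp := hA_mul_hC p
  have hq := hA_mul_hC q
  have key : (cosh (dist p q) ^ 2 - (hA p * hC p - hB p ^ 2) * (hA q * hC q - hB q ^ 2)) *
      det p r x =
      (cosh (dist p q) * cosh (dist p x) - (hA p * hC p - hB p ^ 2) * cosh (dist q x)) *
        det p r q - det p q x * ((hA p * hC p - hB p ^ 2) * cosh (dist q r) -
          cosh (dist p q) * cosh (dist p r)) := by
    simp only [cosh_dist_eq, det]
    ring
  rw [hp, hq] at key
  rw [sinh_sq]
  linear_combination key

/-- The tangent direction at `p` towards `q`, up to a rotation that does not depend on `q`, with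
length `sinh (dist p q)`. -/
noncomputable def tangent (p q : ℍ) : ℂ :=
  ⟨((q.re - p.re) ^ 2 + q.im ^ 2 - p.im ^ 2) / (2 * p.im * q.im), -(q.re - p.re) / q.im⟩

theorem inner_tangent (p q r : ℍ) : inner ℝ (tangent p q) (tangent p r) =
    cosh (dist p q) * cosh (dist p r) - cosh (dist q r) := by
  have hp := p.im_pos.ne'
  have hq := q.im_pos.ne'
  have hr := r.im_pos.ne'
  rw [Complex.inner, UpperHalfPlane.cosh_dist', UpperHalfPlane.cosh_dist',
    UpperHalfPlane.cosh_dist']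
  simp only [tangent, Complex.mul_re, Complex.conj_re, Complex.conj_im]
  field_simp
  ring

theorem norm_tangent (p q : ℍ) : ‖tangent p q‖ = sinh (dist p q) := by
  have h := inner_tangent p q q
  rw [real_inner_self_eq_norm_sq, dist_self, cosh_zero] at h
  have h2 := sinh_sq (dist p q)
  have h3 : 0 ≤ sinh (dist p q) := sinh_nonneg_iff.2 dist_nonneg
  exact (sq_eq_sq₀ (norm_nonneg _) h3).1 (by rw [h, h2]; ring)

/-- The disc coordinate that enters the definition of the angle is a positive multiple of the
tangent vector. -/
theorem tangent_eq (p q : ℍ) : tangent p q = ((1 + cosh (dist p q) : ℝ) : ℂ) *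
    (((q : ℂ) - (p : ℂ)) / ((q : ℂ) - conj (p : ℂ))) := by
  have hp := p.im_pos
  have hq := q.im_pos
  have hne : (q : ℂ) - conj (p : ℂ) ≠ 0 := by
    intro h
    have := congrArg Complex.im h
    simp at this
    linarith
  have ht := UpperHalfPlane.cosh_dist' p q
  rw [mul_div_assoc', eq_div_iff hne]
  generalize cosh (dist p q) = t at ht
  have hp' := hp.ne'
  have hq' := hq.ne'
  apply Complex.ext <;>
  · simp only [tangent, Complex.mul_re, Complex.mul_im, Complex.sub_re, Complex.sub_im,
      Complex.conj_re, Complex.conj_im, Complex.ofReal_re, Complex.ofReal_im,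
      UpperHalfPlane.coe_re, UpperHalfPlane.coe_im, ht]
    field_simp
    ring

theorem hyperbolicAngle_eq (q p r : ℍ) :
    hyperbolicAngle q p r = InnerProductGeometry.angle (tangent p q) (tangent p r) := by
  have h1 : 0 < 1 + cosh (dist p q) := by positivity
  have h2 : 0 < 1 + cosh (dist p r) := by positivity
  rw [tangent_eq, tangent_eq, ← Complex.real_smul, ← Complex.real_smul,
    InnerProductGeometry.angle_smul_left_of_pos _ _ h1,
    InnerProductGeometry.angle_smul_right_of_pos _ _ h2, hyperbolicAngle]

/-- The hyperbolic law of cosines, in the form that defines the angle at `p`. -/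
theorem cos_hyperbolicAngle_mul (q p r : ℍ) :
    cos (hyperbolicAngle q p r) * (sinh (dist p q) * sinh (dist p r)) =
      cosh (dist p q) * cosh (dist p r) - cosh (dist q r) := by
  rw [hyperbolicAngle_eq, ← norm_tangent, ← norm_tangent,
    InnerProductGeometry.cos_angle_mul_norm_mul_norm, inner_tangent]

/-- Points of a line are collinear. -/
theorem det_eq_zero_of_isGeodesicLine {L : Set ℍ} (hL : IsGeodesicLine L) {p q x : ℍ} (hp : p ∈ L)
    (hq : q ∈ L) (hx : x ∈ L) : det p q x = 0 := by
  obtain ⟨γ, hγ, rfl⟩ := hL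
  obtain ⟨a, rfl⟩ := hp
  obtain ⟨b, rfl⟩ := hq
  obtain ⟨c, rfl⟩ := hx
  have h := det_sq (γ a) (γ b) (γ c)
  rw [hγ.dist_eq, hγ.dist_eq, hγ.dist_eq, Real.dist_eq, Real.dist_eq, Real.dist_eq, cosh_abs,
    cosh_abs, cosh_abs, show a - c = (a - b) + (b - c) by ring, cosh_add] at h
  rw [← sq_eq_zero_iff, h]
  linear_combination (-1 + cosh (a - b) ^ 2) * cosh_sq (b - c) + sinh (b - c) ^ 2 * cosh_sq (a - b)

theorem dist_refl {S : ℍ ≃ᵢ ℍ} {p q : ℍ} (hS : IsReflectionIn S p q) (x : ℍ) :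
    dist p (S x) = dist p x ∧ dist q (S x) = dist q x := by
  constructor
  · conv_lhs => rw [← hS.2.1, S.isometry.dist_eq]
  · conv_lhs => rw [← hS.2.2, S.isometry.dist_eq]

theorem det_refl_self {S : ℍ ≃ᵢ ℍ} {p q : ℍ} (hpq : p ≠ q) (hS : IsReflectionIn S p q) (x : ℍ) :
    det p q (S x) = -det p q x := by
  obtain ⟨h1, h2⟩ := dist_refl hS x
  have hd := sinh_dist_pos hpq
  have hsq : det p q (S x) ^ 2 = det p q x ^ 2 := by rw [det_sq, det_sq, h1, h2]
  rcases sq_eq_sq_iff_eq_or_eq_neg.1 hsq with h | h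
  · -- Otherwise `x` would be fixed, hence on the line.
    have e : cosh (dist (S x) x) = cosh (dist x x) := by
      apply mul_left_cancel₀ (pow_pos hd 2).ne'
      rw [sinh_sq_mul_cosh_dist, sinh_sq_mul_cosh_dist, h1, h2, h]
    have hx : S x = x := by
      by_contra hne
      rw [dist_self, cosh_zero] at e
      exact (one_lt_cosh.2 (dist_ne_zero.2 hne)).ne' e
    have := det_eq_zero_of_isGeodesicLine hS.1.2 (p := p) (q := q) (x := x) hS.2.1 hS.2.2 hx
    rw [hx, this, neg_zero]
  · exact h

theorem det_refl {S : ℍ ≃ᵢ ℍ} {p q r : ℍ} (hpq : p ≠ q) (hpr : p ≠ r) (hS : IsReflectionIn S p q)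
    (x : ℍ) : det p r (S x) / sinh (dist p r) = det p r x / sinh (dist p r) -
      2 * cos (hyperbolicAngle q p r) * (det p q x / sinh (dist p q)) := by
  have hd := sinh_dist_pos hpq
  have hd' := sinh_dist_pos hpr
  obtain ⟨h1, h2⟩ := dist_refl hS x
  have k1 := sinh_sq_mul_det p q r (S x)
  have k2 := sinh_sq_mul_det p q r x
  rw [h1, h2, det_refl_self hpq hS x] at k1
  have k3 := cos_hyperbolicAngle_mul q p r
  field_simp
  apply mul_left_cancel₀ hd.ne'
  linear_combination k1 - k2 + 2 * det p q x * k3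

theorem dist_refl_lt {S : ℍ ≃ᵢ ℍ} {p q : ℍ} (hpq : p ≠ q) (hS : IsReflectionIn S p q) (c y : ℍ)
    (h : det p q c * det p q y < 0) : dist c (S y) < dist c y := by
  have hd := sinh_dist_pos hpq
  obtain ⟨h1, h2⟩ := dist_refl hS y
  have k1 := sinh_sq_mul_cosh_dist p q (S y) c
  have k2 := sinh_sq_mul_cosh_dist p q y c
  rw [h1, h2, det_refl_self hpq hS y] at k1
  have h3 : sinh (dist p q) ^ 2 * cosh (dist (S y) c) < sinh (dist p q) ^ 2 * cosh (dist y c) := by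
    linarith
  have h4 := cosh_lt_cosh.1 (lt_of_mul_lt_mul_left h3 (by positivity))
  rwa [abs_of_nonneg dist_nonneg, abs_of_nonneg dist_nonneg, dist_comm, dist_comm y] at h4

theorem eq_of_proportional {p q r : ℍ} (hD : det p q r ≠ 0) {x y : ℍ} {c : ℝ}
    (h0 : det q r x = c * det q r y) (h1 : det r p x = c * det r p y)
    (h2 : det p q x = c * det p q y) : x = y := by
  -- Cramer's rule
  have eA : ∀ z, det p q r * hA z = det q r z * hA p + det r p z * hA q + det p q z * hA r := by
    intro z
    simp only [det]
    ring
  have eB : ∀ z, det p q r * hB z = det q r z * hB p + det r p z * hB q + det p q z * hB r := by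
    intro z
    simp only [det]
    ring
  have eC : ∀ z, det p q r * hC z = det q r z * hC p + det r p z * hC q + det p q z * hC r := by
    intro z
    simp only [det]
    ring
  have fA : hA x = c * hA y := by
    apply mul_left_cancel₀ hD
    rw [eA, mul_left_comm, eA, h0, h1, h2]
    ring
  have fB : hB x = c * hB y := by
    apply mul_left_cancel₀ hD
    rw [eB, mul_left_comm, eB, h0, h1, h2]
    ring
  have fC : hC x = c * hC y := by
    apply mul_left_cancel₀ hD
    rw [eC, mul_left_comm, eC, h0, h1, h2]
    ring
  have hx := hA_mul_hC x
  have hy := hA_mul_hC y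
  have hc2 : c ^ 2 = 1 := by
    rw [fA, fB, fC] at hx
    linear_combination hx - c ^ 2 * hy
  have hcpos : 0 < c := by
    have := hC_pos x
    rw [fC] at this
    exact pos_of_mul_pos_left this (hC_pos y).le
  have hc : c = 1 := by nlinarith
  rw [hc, one_mul] at fB fC
  have him : x.im = y.im := by
    unfold hC at fC
    simpa using fC
  refine UpperHalfPlane.ext_re_im ?_ him
  unfold hB at fB
  rw [him] at fB
  exact (div_left_inj' y.im_pos.ne').1 fB

/-- The point represented by a multiple of a given vector of positive norm. -/
theorem exists_point {A B C : ℝ} (hC' : 0 < C) (h : 0 < A * C - B ^ 2) :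
    ∃ z : ℍ, ∃ t, 0 < t ∧ hA z = t * A ∧ hB z = t * B ∧ hC z = t * C := by
  have hs := Real.sqrt_pos.2 h
  have hss := Real.sq_sqrt h.le
  refine ⟨⟨⟨B / C, √(A * C - B ^ 2) / C⟩, div_pos hs hC'⟩, 1 / √(A * C - B ^ 2), by positivity,
    ?_, ?_, ?_⟩
  · change ((B / C) ^ 2 + (√(A * C - B ^ 2) / C) ^ 2) / (√(A * C - B ^ 2) / C) = _
    rw [div_pow, div_pow, hss]
    field_simp
    ring
  · change (B / C) / (√(A * C - B ^ 2) / C) = _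
    field_simp
  · change 1 / (√(A * C - B ^ 2) / C) = _
    field_simp

/-- The point represented by a multiple of the sum of the three vectors. -/
theorem exists_interior (p q r : ℍ) : ∃ c t, 0 < t ∧ det q r c = t * det p q r ∧
    det r p c = t * det p q r ∧ det p q c = t * det p q r := by
  have hp := hA_mul_hC p
  have hq := hA_mul_hC q
  have hr := hA_mul_hC r
  have hpq := cosh_dist_eq p q
  have hpr := cosh_dist_eq p r
  have hqr := cosh_dist_eq q r
  have := cosh_pos (dist p q)
  have := cosh_pos (dist p r)
  have := cosh_pos (dist q r)
  have := hC_pos p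
  have := hC_pos q
  have := hC_pos r
  obtain ⟨c, t, ht, eA, eB, eC⟩ := exists_point (A := hA p + hA q + hA r) (B := hB p + hB q + hB r)
    (C := hC p + hC q + hC r) (by positivity) (by nlinarith)
  refine ⟨c, t, ht, ?_, ?_, ?_⟩ <;>
  · unfold det
    rw [eA, eB, eC]
    ring

/-- The hyperbolic plane. -/
noncomputable def model : PlaneModel ℍ hyperbolicAngle where
  det := det
  len p q := sinh (dist p q)
  angle_comm q p r := InnerProductGeometry.angle_comm _ _
  det_swap p q r := by simp only [det]; ring
  det_rotate p q r := by simp only [det]; ring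
  len_comm p q := by rw [dist_comm]
  len_pos p q h := sinh_dist_pos h
  continuous_det p q := by
    have hne : ∀ z : ℍ, z.im ≠ 0 := fun z => z.im_pos.ne'
    have h1 := UpperHalfPlane.continuous_re
    have h2 := UpperHalfPlane.continuous_im
    unfold det hA hB hC
    fun_prop (disch := assumption)
  det_ne_zero p q r hq hr h := by
    have h1 := cos_hyperbolicAngle_mul q p r
    rw [h, cos_pi_div_two, zero_mul] at h1
    have h2 := det_sq p q r
    have h3 := sinh_dist_pos hq.symm
    have h4 := sinh_dist_pos hr.symm
    have h5 := sinh_sq (dist p q)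
    have h6 := sinh_sq (dist p r)
    have h7 : det p q r ^ 2 = sinh (dist p q) ^ 2 * sinh (dist p r) ^ 2 := by
      rw [h2, h5, h6]
      linear_combination (cosh (dist p q) * cosh (dist p r) - cosh (dist q r)) * h1
    have h8 : 0 < det p q r ^ 2 := h7 ▸ by positivity
    exact fun h0 => by simp [h0] at h8
  eq_of_proportional p q r hD x y c := eq_of_proportional hD
  exists_interior := exists_interior
  det_refl_self S p q hpq hS x := det_refl_self hpq hS x
  det_refl S p q r hpq hpr hS x := det_refl hpq hpr hS x
  dist_refl_lt S p q hpq hS c y := dist_refl_lt hpq hS c y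

end HyperbolicModel

theorem two_le_of_one_div_add_one_div_le {m n : ℕ} (hm : 0 < m) (hn : 0 < n)
    (h : (1 : ℝ) / m + 1 / n ≤ 1 / 2) : 2 ≤ m := by
  by_contra! hlt
  have : m = 1 := by omega
  subst this
  have : (0 : ℝ) < 1 / n := by positivity
  rw [Nat.cast_one, div_one] at h
  linarith

theorem mainTheorem3 (m n : ℕ) (hm : 0 < m) (hn : 0 < n) :
    ((1 : ℝ) / m + 1 / n = 1 / 2 →
      ∀ U : UniversalMap ℂ EuclideanGeometry.angle m n, U.PatternTable) ∧
    ((1 : ℝ) / m + 1 / n < 1 / 2 →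
      ∀ U : UniversalMap ℍ hyperbolicAngle m n, U.PatternTable) :=
  ⟨fun h U => (EuclideanModel.model.sideCoordinates (two_le_of_one_div_add_one_div_le hm hn h.le)
      (two_le_of_one_div_add_one_div_le hn hm (by linarith)) U).patternTable,
    fun h U => (HyperbolicModel.model.sideCoordinates (two_le_of_one_div_add_one_div_le hm hn h.le)
      (two_le_of_one_div_add_one_div_le hn hm (by linarith)) U).patternTable⟩
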